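/- **Conventions.** $\mathbb N=\{1,2,3,\dots\}$, $\mathcal Z=\mathbb Z[t^{\pm1}]$ with involution $\overline{t}=t^{-1}$. $\mathcal Q$ is the $\mathcal Z$-module of Laurent polynomials with coefficients in $\mathbb Q/\mathbb Z$, and for an abelian group $A$, $A[[t^{\pm}]]$ is the $\mathcal Z$-module of all formal sums $\sum_{m\in\mathbb Z}c_mt^m$ with $c_m\in A$. A biadditive form $f:M\times N\to\mathbb Q/\mathbb Z$ is *nondegenerate* if for every $0\ne m\in M$ there is $n\in N$ with $f(m,n)\neq0$ and for every $0\neq n\in N$ there is $m\in M$ with $f(m,n)\ne 0$. A *finite order planon-only fusion theory* is a finitely generated $\mathcal Z$-module $S$ in which every element has finite additive order and no nonzero element is fixed by $t^k$ for any $k\neq 0$. A *p-theory* $(S,b)$ is such an $S$ with a symmetric $\mathbb Z$-bilinear form $b:S\times S\to\mathbb Q/\mathbb Z$ that is translation-invariant, $b(t^kx,t^ky)=b(x,y)$, and local: for all $x,y\in S$ there is $\ell\in\mathbb N$ such that $b(t^kx,y)=0$ whenever $|k|\ge\ell$. It is *p-modular* if $b$ is nondegenerate. (The condition that no nonzero element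 is fixed by a nontrivial translation follows from p-modularity and the other conditions.) A *theory of excitations* $(S,\theta)$ is such an $S$ with a quadratic form $\theta:S\to\mathbb Q/\mathbb Z$ (that is, $b(x,y)=\theta(x+y)-\theta(x)-\theta(y)$ is $\mathbb Z$-bilinear and $b(x,x)=2\theta(x)$) satisfying $\theta(t^kx)=\theta(x)$ and such that $b$ is local. Its associated p-theory is $(S,b)$; it is *p-modular* if $b$ is nondegenerate. Given a p-theory $(S,b)$: * $B(x,y)=\sum_{m\in\mathbb Z}b(t^mx,y)\,t^m\in\mathcal Q$. Let $S^*=\operatorname{Hom}_{\mathcal Z}(S,\mathcal Q)$ with module structure $(r\varphi)(x)=\varphi(\overline r x)$, and let $\Phi:S\to S^*$ be the $\mathcal Z$-linear map $\Phi(x)=B(x,\cdot)$. The p-theory is *perfect* if $\Phi$ is an isomorphism. * $\widetilde S=S\otimes_{\mathcal Z}\mathbb Z[[t^\pm]]$, and $\tilde b:S\times\widetilde S\to\mathbb Q/\mathbb Z$ is the biadditive form for which $\tilde b(x,y\otimes z)$ is the coefficient of $t^0$ in the product $B(x,y)\,z\in(\mathbb Q/\mathbb Z)[[t^\pm]]$.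 Let $\widetilde S^{per}=\{\tilde x\in\widetilde S\mid t^N\tilde x=\tilde x\text{ for some }N\in\mathbb N\}$ and let $\tilde b^{per}$ be the restriction of $\tilde b$ to $S\times\widetilde S^{per}$. * For $N\in\mathbb N$ let $S_N=S/(1-t^N)S$ with quotient map $\rho:S\to S_N$, and let $b_N:S_N\times S_N\to\mathbb Q/\mathbb Z$ be the well-defined form $b_N(\rho(x),\rho(y))=\sum_{m\in\mathbb Z}b(t^{mN}x,y)$. For a theory of excitations, let $\theta_N:S_N\to\mathbb Q/\mathbb Z$ be the well-defined quadratic form $\theta_N(\rho(x))=\theta(x)+\sum_{m>0}b(x,t^{mN}x)$. * A *modular p-theory of abelian anyons* is a finite abelian group with a nondegenerate symmetric bilinear form valued in $\mathbb Q/\mathbb Z$. A *modular theory of abelian anyons* is a finite abelian group with a quadratic form valued in $\mathbb Q/\mathbb Z$ whose associated bilinear form is nondegenerate. **Theorem.** (A) Let $(S,b)$ be a p-modular p-theory. The following are equivalent: 1. $\tilde b:S\times\widetilde S\to\mathbb Q/\mathbb Z$ is nondegenerate. 2. $\tilde b^{per}:S\times\widetilde S^{per}\to\mathbb Q/\mathbb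 Z$ is nondegenerate. 3. For all $N\in\mathbb N$, $(S_N,b_N)$ is a modular p-theory of abelian anyons. 4. There is $N_0\in\mathbb N$ such that for all $N\ge N_0$, $(S_N,b_N)$ is a modular p-theory of abelian anyons. 5. $(S,b)$ is perfect. (B) Let $(S,\theta)$ be a p-modular theory of excitations, with associated p-theory $(S,b)$. The five conditions are equivalent when in 3 and 4 "$(S_N,b_N)$ is a modular p-theory of abelian anyons" is replaced by "$(S_N,\theta_N)$ is a modular theory of abelian anyons" (conditions 1, 2 and 5 refer to $(S,b)$). -/

import Mathlib

open scoped LaurentPolynomial TensorProduct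

noncomputable section

namespace Planon

open LaurentPolynomial

universe u

/-- The group `ℚ/ℤ`. -/
abbrev QZ : Type := AddCircle (1 : ℚ)

/-! ### Auxiliary constructions -/

/-- A biadditive function, as a `ℤ`-bilinear map. -/
def bilinOfAdd {M N P : Type*} [AddCommGroup M] [AddCommGroup N] [AddCommGroup P]
    (f : M → N → P) (hl : ∀ x x' y, f (x + x') y = f x y + f x' y)
    (hr : ∀ x y y', f x (y + y') = f x y + f x y') : M →ₗ[ℤ] N →ₗ[ℤ] P :=
  (AddMonoidHom.mk' (fun x => (AddMonoidHom.mk' (f x) (hr x)).toIntLinearMap)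
    (fun x x' => by ext y; exact hl x x' y)).toIntLinearMap

@[simp] theorem bilinOfAdd_apply {M N P : Type*} [AddCommGroup M] [AddCommGroup N]
    [AddCommGroup P] (f : M → N → P) (hl : ∀ x x' y, f (x + x') y = f x y + f x' y)
    (hr : ∀ x y y', f x (y + y') = f x y + f x y') (x : M) (y : N) :
    bilinOfAdd f hl hr x y = f x y := rfl

theorem C_smul {M : Type*} [AddCommGroup M] [Module ℤ[T;T⁻¹] M] (a : ℤ) (x : M) :
    (C a : ℤ[T;T⁻¹]) • x = a • x := by
  rw [← Int.cast_smul_eq_zsmul (ℤ[T;T⁻¹]) a x]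
  congr 1

/-- An additive map that commutes with all translations is linear over Laurent polynomials. -/
def linOfShift {M N : Type*} [AddCommGroup M] [AddCommGroup N] [Module ℤ[T;T⁻¹] M]
    [Module ℤ[T;T⁻¹] N] (f : M → N) (hadd : ∀ x y, f (x + y) = f x + f y)
    (hT : ∀ (k : ℤ) (x : M), f ((T k : ℤ[T;T⁻¹]) • x) = (T k : ℤ[T;T⁻¹]) • f x) :
    M →ₗ[ℤ[T;T⁻¹]] N where
  toFun := f
  map_add' := hadd
  map_smul' r x := by
    induction r using LaurentPolynomial.induction_on' with
    | add p q hp hq => simp only [RingHom.id_apply] at hp hq ⊢; rw [add_smul, hadd, hp, hq, add_smul]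
    | C_mul_T n a =>
      simp only [RingHom.id_apply]
      rw [mul_smul, mul_smul, C_smul, C_smul, ← hT]
      exact map_zsmul (AddMonoidHom.mk' f hadd) a _

@[simp] theorem linOfShift_apply {M N : Type*} [AddCommGroup M] [AddCommGroup N]
    [Module ℤ[T;T⁻¹] M] [Module ℤ[T;T⁻¹] N] (f : M → N) (hadd) (hT) (x : M) :
    linOfShift f hadd hT x = f x := rfl

/-! ### Laurent formal sums and Laurent polynomials with coefficients in an abelian group -/

/-- Laurent formal sums `∑ m, c m t ^ m`, with `c m ∈ A` and arbitrary support. -/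
def FormalSum (A : Type*) : Type _ := ℤ → A

instance (A : Type*) [AddCommGroup A] : AddCommGroup (FormalSum A) :=
  inferInstanceAs (AddCommGroup (ℤ → A))

/-- Multiplication of formal sums by `t ^ k`. -/
def shiftHom (A : Type*) [AddCommGroup A] : Multiplicative ℤ →* Module.End ℤ (FormalSum A) where
  toFun k := (AddMonoidHom.mk' (fun (f : FormalSum A) => ((fun m : ℤ => f (m - k.toAdd)) : FormalSum A))
    (fun _ _ => rfl)).toIntLinearMap
  map_one' := by
    refine LinearMap.ext fun f => ?_
    funext m
    exact congrArg f (sub_zero m)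
  map_mul' k l := by
    refine LinearMap.ext fun f => ?_
    funext m
    refine congrArg f ?_
    change m - (k.toAdd + l.toAdd) = m - k.toAdd - l.toAdd
    ring

/-- The module structure over Laurent polynomials for which `t` shifts the coefficients. -/
instance (A : Type*) [AddCommGroup A] : Module ℤ[T;T⁻¹] (FormalSum A) :=
  Module.compHom (FormalSum A)
    (AddMonoidAlgebra.lift ℤ (Module.End ℤ (FormalSum A)) ℤ (shiftHom A)).toRingHom

theorem T_smul_formalSum {A : Type*} [AddCommGroup A] (k : ℤ) (f : FormalSum A) (m : ℤ) :
    ((T k : ℤ[T;T⁻¹]) • f) m = f (m - k) := by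
  change (AddMonoidAlgebra.lift ℤ (Module.End ℤ (FormalSum A)) ℤ (shiftHom A)
    (AddMonoidAlgebra.single k 1)) f m = _
  rw [AddMonoidAlgebra.lift_single]
  simp only [one_smul]
  rfl

theorem add_formalSum_apply {A : Type*} [AddCommGroup A] (f g : FormalSum A) (m : ℤ) :
    (f + g) m = f m + g m := rfl

theorem zsmul_formalSum_apply {A : Type*} [AddCommGroup A] (a : ℤ) (f : FormalSum A) (m : ℤ) :
    (a • f) m = a • f m := rfl

/-- Laurent polynomials with coefficients in the abelian group `A`: the formal sums with finitely
many nonzero coefficients. -/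
def LaurentSum (A : Type*) [AddCommGroup A] : Submodule ℤ[T;T⁻¹] (FormalSum A) where
  carrier := {f | {m : ℤ | f m ≠ 0}.Finite}
  zero_mem' := by
    have : {m : ℤ | (0 : FormalSum A) m ≠ 0} = ∅ :=
      Set.eq_empty_of_forall_notMem fun m hm => hm rfl
    change {m : ℤ | (0 : FormalSum A) m ≠ 0}.Finite
    rw [this]; exact Set.finite_empty
  add_mem' {f g} hf hg := by
    refine (Set.Finite.union hf hg).subset fun m hm => ?_
    by_contra h
    simp only [Set.mem_union, Set.mem_ofPred_eq, not_or, not_not] at h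
    exact hm (by rw [add_formalSum_apply, h.1, h.2, add_zero])
  smul_mem' r f hf := by
    induction r using LaurentPolynomial.induction_on' with
    | add p q hp hq =>
      refine (Set.Finite.union hp hq).subset fun m hm => ?_
      by_contra h
      simp only [Set.mem_union, Set.mem_ofPred_eq, not_or, not_not] at h
      exact hm (by rw [add_smul, add_formalSum_apply, h.1, h.2, add_zero])
    | C_mul_T n a =>
      refine (Set.Finite.image (fun m => m + n) hf).subset fun m hm => ?_
      refine ⟨m - n, fun h => hm ?_, by simp⟩
      rw [mul_smul, C_smul, zsmul_formalSum_apply, T_smul_formalSum, h, smul_zero]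

/-- The product `q z` of a Laurent polynomial `q` with coefficients in `ℚ/ℤ` and an integral formal
sum `z`; its coefficient of `t ^ m` is the finite sum `∑ i, z_(m - i) q_i`. -/
def mulFormal (q : LaurentSum QZ) (z : FormalSum ℤ) : FormalSum QZ :=
  fun m => ∑ᶠ i : ℤ, z (m - i) • q.1 i

theorem mulFormal_support (q : LaurentSum QZ) (z : FormalSum ℤ) (m : ℤ) :
    (Function.support fun i : ℤ => z (m - i) • q.1 i).Finite := by
  refine Set.Finite.subset q.2 fun i hi h => hi ?_
  change z (m - i) • q.1 i = 0
  rw [h, smul_zero]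

/-- The product of Laurent polynomials and formal sums as a bilinear map. -/
def mulFormalHom : LaurentSum QZ →ₗ[ℤ[T;T⁻¹]] FormalSum ℤ →ₗ[ℤ[T;T⁻¹]] FormalSum QZ :=
  linOfShift
    (fun q => linOfShift (mulFormal q)
      (fun z w => by
        funext m
        change ∑ᶠ i : ℤ, (z (m - i) + w (m - i)) • q.1 i = mulFormal q z m + mulFormal q w m
        simp only [add_smul]
        exact finsum_add_distrib (mulFormal_support q z m) (mulFormal_support q w m))
      (fun k z => by
        funext m
        rw [T_smul_formalSum]
        refine finsum_congr fun i => ?_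
        rw [T_smul_formalSum, sub_right_comm]))
    (fun q r => by
      ext z
      funext m
      change ∑ᶠ i : ℤ, z (m - i) • (q.1 i + r.1 i) = mulFormal q z m + mulFormal r z m
      simp only [smul_add]
      exact finsum_add_distrib (mulFormal_support q z m) (mulFormal_support r z m))
    (fun k q => by
      ext z
      funext m
      rw [LinearMap.smul_apply, T_smul_formalSum]
      change ∑ᶠ i : ℤ, z (m - i) • ((T k : ℤ[T;T⁻¹]) • q.1) i = ∑ᶠ i : ℤ, z (m - k - i) • q.1 i
      rw [← finsum_comp_equiv (Equiv.addRight k)]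
      refine finsum_congr fun i => ?_
      rw [T_smul_formalSum, Equiv.coe_addRight, add_sub_cancel_right, sub_sub, add_comm k i])

/-! ### Fusion theories, p-theories, theories of excitations -/

/-- A planon-only fusion theory of finite order: a finitely generated module over `ℤ[t, t⁻¹]`, all
of whose elements have finite order, with no nonzero element fixed by a nontrivial translation. -/
structure IsFusionTheory (S : Type u) [AddCommGroup S] [Module ℤ[T;T⁻¹] S] : Prop where
  fg : Module.Finite ℤ[T;T⁻¹] S
  immobile : ∀ x : S, x ≠ 0 → ∀ k : ℤ, (T k : ℤ[T;T⁻¹]) • x = x → k = 0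
  finite_order : ∀ x : S, ∃ m : ℕ, 0 < m ∧ m • x = 0

/-- A p-theory: a finite order planon-only fusion theory together with a symmetric,
translation-invariant, local bilinear form with values in `ℚ/ℤ`. -/
structure PTheory (S : Type u) [AddCommGroup S] [Module ℤ[T;T⁻¹] S] where
  fusion : IsFusionTheory S
  b : LinearMap.BilinMap ℤ S QZ
  symm : ∀ x y, b x y = b y x
  transl : ∀ (k : ℤ) (x y : S), b ((T k : ℤ[T;T⁻¹]) • x) ((T k : ℤ[T;T⁻¹]) • y) = b x y
  locality : ∀ x y : S, ∃ l : ℕ, ∀ k : ℤ, (l : ℤ) ≤ |k| → b ((T k : ℤ[T;T⁻¹]) • x) y = 0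

/-- A theory of excitations: a finite order planon-only fusion theory together with a
translation-invariant, local quadratic form with values in `ℚ/ℤ`. -/
structure TheoryOfExcitations (S : Type u) [AddCommGroup S] [Module ℤ[T;T⁻¹] S] where
  fusion : IsFusionTheory S
  θ : QuadraticMap ℤ S QZ
  transl : ∀ (k : ℤ) (x : S), θ ((T k : ℤ[T;T⁻¹]) • x) = θ x
  locality : ∀ x y : S, ∃ l : ℕ, ∀ k : ℤ, (l : ℤ) ≤ |k| →
    QuadraticMap.polar θ ((T k : ℤ[T;T⁻¹]) • x) y = 0

section

variable {S : Type u} [AddCommGroup S] [Module ℤ[T;T⁻¹] S]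

/-- The p-theory associated with a theory of excitations, with
`b x y = θ (x + y) - θ x - θ y`. -/
def TheoryOfExcitations.toPTheory (E : TheoryOfExcitations S) : PTheory S where
  fusion := E.fusion
  b := E.θ.polarBilin
  symm x y := QuadraticMap.polar_comm E.θ x y
  transl k x y := by
    simp only [QuadraticMap.polarBilin_apply_apply, QuadraticMap.polar, ← smul_add, E.transl]
  locality x y := by simpa only [QuadraticMap.polarBilin_apply_apply] using E.locality x y

namespace PTheory

/-- p-modularity is nondegeneracy of `b`. -/
def IsPModular (P : PTheory S) : Prop := P.b.Nondegenerate

variable (P : PTheory S)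

theorem b_T_left (k : ℤ) (x y : S) :
    P.b ((T k : ℤ[T;T⁻¹]) • x) y = P.b x ((T (-k) : ℤ[T;T⁻¹]) • y) := by
  rw [← P.transl (-k), ← mul_smul, ← T_add, neg_add_cancel, T_zero, one_smul]

theorem b_T_right (k : ℤ) (x y : S) :
    P.b x ((T k : ℤ[T;T⁻¹]) • y) = P.b ((T (-k) : ℤ[T;T⁻¹]) • x) y := by
  rw [b_T_left, neg_neg]

theorem finite_support (x y : S) : {k : ℤ | P.b ((T k : ℤ[T;T⁻¹]) • x) y ≠ 0}.Finite := by
  obtain ⟨l, hl⟩ := P.locality x y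
  refine (Set.finite_Icc (-(l : ℤ)) l).subset fun k hk => ?_
  by_contra h
  refine hk (hl k ?_)
  rw [Set.mem_Icc, ← abs_le] at h
  omega

/-- The Laurent polynomial `B(x, y) = ∑ m, b (t ^ m x) y t ^ m`. -/
def BForm (x y : S) : LaurentSum QZ :=
  ⟨fun m => P.b ((T m : ℤ[T;T⁻¹]) • x) y, P.finite_support x y⟩

/-- The linear map `B(x, ·)`. -/
def BFormHom (x : S) : S →ₗ[ℤ[T;T⁻¹]] LaurentSum QZ :=
  linOfShift (P.BForm x)
    (fun y z => by
      apply Subtype.ext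
      funext m
      exact map_add (P.b ((T m : ℤ[T;T⁻¹]) • x)) y z)
    (fun k y => by
      apply Subtype.ext
      funext m
      rw [Submodule.coe_smul, T_smul_formalSum]
      change P.b ((T m : ℤ[T;T⁻¹]) • x) ((T k : ℤ[T;T⁻¹]) • y) =
        P.b ((T (m - k) : ℤ[T;T⁻¹]) • x) y
      rw [b_T_right, ← mul_smul, ← T_add, neg_add_eq_sub])

end PTheory

variable (S) in
/-- The dual `S* = Hom(S, 𝒬)`, where `𝒬` is the module of Laurent polynomials over `ℚ/ℤ`, with
module structure `(r φ)(x) = φ(r̄ x)`, twisted by the involution `t ↦ t⁻¹`. -/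
def Dual : Type u := S →ₗ[ℤ[T;T⁻¹]] LaurentSum QZ

instance : AddCommGroup (Dual S) := inferInstanceAs (AddCommGroup (S →ₗ[ℤ[T;T⁻¹]] LaurentSum QZ))

instance : Module ℤ[T;T⁻¹] (Dual S) :=
  Module.compHom (S →ₗ[ℤ[T;T⁻¹]] LaurentSum QZ)
    ((invert : ℤ[T;T⁻¹] ≃ₐ[ℤ] ℤ[T;T⁻¹]) : ℤ[T;T⁻¹] →+* ℤ[T;T⁻¹])

/-- Evaluation of an element of the dual. -/
def Dual.eval (φ : Dual S) : S →ₗ[ℤ[T;T⁻¹]] LaurentSum QZ := φ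

theorem Dual.smul_eval (r : ℤ[T;T⁻¹]) (φ : Dual S) (x : S) :
    (r • φ).eval x = φ.eval (invert r • x) := ((Dual.eval φ).map_smul (invert r) x).symm

namespace PTheory

variable (P : PTheory S)

/-- The associated map `Φ : S → S*`, `x ↦ B(x, ·)`. -/
def Φ : S →ₗ[ℤ[T;T⁻¹]] Dual S :=
  linOfShift (N := Dual S) (fun x => P.BFormHom x)
    (fun x y => by
      refine LinearMap.ext fun z => Subtype.ext ?_
      funext m
      change P.b ((T m : ℤ[T;T⁻¹]) • (x + y)) z =
        P.b ((T m : ℤ[T;T⁻¹]) • x) z + P.b ((T m : ℤ[T;T⁻¹]) • y) z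
      rw [smul_add, map_add, LinearMap.add_apply])
    (fun k x => by
      refine LinearMap.ext fun z => ?_
      have h := Dual.smul_eval (T k) (P.BFormHom x : Dual S) z
      refine Eq.trans (Subtype.ext ?_) h.symm
      funext m
      change P.b ((T m : ℤ[T;T⁻¹]) • (T k : ℤ[T;T⁻¹]) • x) z =
        P.b ((T m : ℤ[T;T⁻¹]) • x) ((invert (T k) : ℤ[T;T⁻¹]) • z)
      rw [invert_T, b_T_right, neg_neg, ← mul_smul, ← mul_smul, ← T_add, ← T_add, add_comm])

/-- A p-theory is perfect if `Φ` is an isomorphism of modules. -/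
def IsPerfect : Prop := Function.Bijective P.Φ

end PTheory

/-! ### Infinite excitations -/

variable (S) in
/-- The module of infinite excitations, the tensor product of `S` with the formal sums over `ℤ`. -/
def InfExc : Type u := S ⊗[ℤ[T;T⁻¹]] FormalSum ℤ

instance : AddCommGroup (InfExc S) := inferInstanceAs (AddCommGroup (S ⊗[ℤ[T;T⁻¹]] FormalSum ℤ))

instance : Module ℤ[T;T⁻¹] (InfExc S) :=
  inferInstanceAs (Module ℤ[T;T⁻¹] (S ⊗[ℤ[T;T⁻¹]] FormalSum ℤ))

variable (S) in
/-- The submodule of periodic excitations, those fixed by `t ^ N` for some `N ≥ 1`. -/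
def PerExc : Submodule ℤ[T;T⁻¹] (InfExc S) where
  carrier := {x | ∃ N : ℕ+, (T (N : ℤ) : ℤ[T;T⁻¹]) • x = x}
  zero_mem' := ⟨1, smul_zero _⟩
  add_mem' {x y} := by
    have key : ∀ (z : InfExc S) (N : ℤ), (T N : ℤ[T;T⁻¹]) • z = z → ∀ k : ℕ,
        (T (k * N) : ℤ[T;T⁻¹]) • z = z := by
      intro z N hz k
      induction k with
      | zero => simp [T_zero]
      | succ k ih =>
        push_cast
        rw [add_mul, one_mul, T_add, mul_smul, hz, ih]
    rintro ⟨N, hN⟩ ⟨M, hM⟩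
    refine ⟨M * N, ?_⟩
    have h1 := key x N hN M
    have h2 := key y M hM N
    rw [mul_comm] at h2
    rw [smul_add]
    push_cast
    exact congrArg₂ (· + ·) h1 h2
  smul_mem' r x := by
    rintro ⟨N, hN⟩
    exact ⟨N, by rw [smul_comm, hN]⟩

namespace PTheory

variable (P : PTheory S)

/-- The linear map `B̃(x, ·)`, which sends `y ⊗ z` to the product `B(x, y) z`. -/
def BTilde (x : S) : InfExc S →ₗ[ℤ[T;T⁻¹]] FormalSum QZ :=
  TensorProduct.lift (mulFormalHom ∘ₗ P.BFormHom x)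

theorem BTilde_tmul (x y : S) (z : FormalSum ℤ) :
    P.BTilde x (y ⊗ₜ[ℤ[T;T⁻¹]] z : S ⊗[ℤ[T;T⁻¹]] FormalSum ℤ) = mulFormal (P.BForm x y) z := rfl

/-- The form `b̃ : S × S̃ → ℚ/ℤ`, the coefficient of `t ^ 0` in `B̃`. -/
def bTilde : S →ₗ[ℤ] InfExc S →ₗ[ℤ] QZ :=
  bilinOfAdd (fun x y => P.BTilde x y 0)
    (fun x x' y => by
      have h : mulFormalHom ∘ₗ P.BFormHom (x + x') =
          mulFormalHom ∘ₗ P.BFormHom x + mulFormalHom ∘ₗ P.BFormHom x' := by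
        rw [show P.BFormHom (x + x') = P.BFormHom x + P.BFormHom x' from map_add P.Φ x x',
          LinearMap.comp_add]
      have h2 : P.BTilde (x + x') = P.BTilde x + P.BTilde x' := by
        unfold BTilde
        rw [h]
        exact map_add (TensorProduct.lift.equiv (RingHom.id ℤ[T;T⁻¹]) S (FormalSum ℤ) (FormalSum QZ)) _ _
      rw [h2]
      rfl)
    (fun x y y' => by rw [map_add]; rfl)

/-- The restriction of `b̃` to periodic excitations. -/
def bTildePer : S →ₗ[ℤ] PerExc S →ₗ[ℤ] QZ :=
  bilinOfAdd (fun x y => P.bTilde x y.1)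
    (fun x x' y => by rw [map_add, LinearMap.add_apply])
    (fun x y y' => by rw [Submodule.coe_add, map_add])

end PTheory

/-! ### Compactification -/

variable (S) in
/-- The length-`N` compactification `S_N = S / (1 - t ^ N) S`. -/
def Compact (N : ℕ+) : Type u :=
  S ⧸ (Ideal.span {(1 - T (N : ℤ) : ℤ[T;T⁻¹])} • (⊤ : Submodule ℤ[T;T⁻¹] S))

instance (N : ℕ+) : AddCommGroup (Compact S N) := inferInstanceAs (AddCommGroup
  (S ⧸ (Ideal.span {(1 - T (N : ℤ) : ℤ[T;T⁻¹])} • (⊤ : Submodule ℤ[T;T⁻¹] S))))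

instance (N : ℕ+) : Module ℤ[T;T⁻¹] (Compact S N) := inferInstanceAs (Module ℤ[T;T⁻¹]
  (S ⧸ (Ideal.span {(1 - T (N : ℤ) : ℤ[T;T⁻¹])} • (⊤ : Submodule ℤ[T;T⁻¹] S))))

/-- The quotient map `ρ : S → S_N`. -/
def ρ (N : ℕ+) : S →ₗ[ℤ[T;T⁻¹]] Compact S N := Submodule.mkQ _

theorem ρ_surjective (N : ℕ+) : Function.Surjective (ρ (S := S) N) := Submodule.mkQ_surjective _

theorem ρ_eq_iff (N : ℕ+) (x y : S) :
    ρ N x = ρ N y ↔ ∃ z : S, x - y = z - (T (N : ℤ) : ℤ[T;T⁻¹]) • z := by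
  refine (Submodule.Quotient.eq _).trans ?_
  rw [Submodule.ideal_span_singleton_smul, Submodule.mem_smul_pointwise_iff_exists]
  simp only [Submodule.mem_top, true_and, sub_smul, one_smul, eq_comm]

namespace PTheory

variable (P : PTheory S)

theorem finite_support_N (N : ℕ+) (x y : S) :
    (Function.support fun m : ℤ => P.b ((T (m * N) : ℤ[T;T⁻¹]) • x) y).Finite := by
  refine Set.Finite.preimage (f := fun m : ℤ => m * (N : ℤ)) (fun m _ m' _ h => ?_)
    (P.finite_support x y)
  exact mul_right_cancel₀ (by exact_mod_cast N.ne_zero) h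

/-- The sum `∑ m, b (t ^ (m N) x) y`, as a form on `S`. -/
def bPre (N : ℕ+) : LinearMap.BilinMap ℤ S QZ :=
  bilinOfAdd (fun x y => ∑ᶠ m : ℤ, P.b ((T (m * N) : ℤ[T;T⁻¹]) • x) y)
    (fun x x' y => by
      simp only [smul_add, map_add, LinearMap.add_apply]
      exact finsum_add_distrib (P.finite_support_N N x y) (P.finite_support_N N x' y))
    (fun x y y' => by
      simp only [map_add]
      exact finsum_add_distrib (P.finite_support_N N x y) (P.finite_support_N N x y'))

theorem bPre_T_left (N : ℕ+) (x y : S) :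
    P.bPre N ((T (N : ℤ) : ℤ[T;T⁻¹]) • x) y = P.bPre N x y := by
  change ∑ᶠ m : ℤ, P.b ((T (m * N) : ℤ[T;T⁻¹]) • (T (N : ℤ) : ℤ[T;T⁻¹]) • x) y =
    ∑ᶠ m : ℤ, P.b ((T (m * N) : ℤ[T;T⁻¹]) • x) y
  rw [← finsum_comp_equiv (Equiv.addRight (1 : ℤ))
    (f := fun m : ℤ => P.b ((T (m * N) : ℤ[T;T⁻¹]) • x) y)]
  refine finsum_congr fun m => ?_
  rw [← mul_smul, ← T_add, Equiv.coe_addRight, add_mul, one_mul]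

theorem bPre_T_right (N : ℕ+) (x y : S) :
    P.bPre N x ((T (N : ℤ) : ℤ[T;T⁻¹]) • y) = P.bPre N x y := by
  rw [← P.bPre_T_left N x ((T (N : ℤ) : ℤ[T;T⁻¹]) • y)]
  refine finsum_congr fun m => ?_
  rw [smul_comm, P.transl]

theorem bPre_congr (N : ℕ+) {x x' y y' : S} (hx : ρ N x = ρ N x') (hy : ρ N y = ρ N y') :
    P.bPre N x y = P.bPre N x' y' := by
  obtain ⟨z, hz⟩ := (ρ_eq_iff N x x').1 hx
  obtain ⟨w, hw⟩ := (ρ_eq_iff N y y').1 hy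
  rw [sub_eq_iff_eq_add.1 hz, sub_eq_iff_eq_add.1 hw]
  simp only [map_add, map_sub, LinearMap.add_apply, LinearMap.sub_apply, bPre_T_left, bPre_T_right,
    sub_self, zero_add]

/-- The form `b_N` on `S_N`. -/
def bN (N : ℕ+) : LinearMap.BilinMap ℤ (Compact S N) QZ :=
  bilinOfAdd (fun x y => P.bPre N (Function.surjInv (ρ_surjective N) x)
      (Function.surjInv (ρ_surjective N) y))
    (fun x x' y => by
      rw [← LinearMap.add_apply, ← map_add]
      refine P.bPre_congr N ?_ rfl
      rw [map_add]
      simp only [Function.surjInv_eq])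
    (fun x y y' => by
      rw [← map_add]
      refine P.bPre_congr N rfl ?_
      rw [map_add]
      simp only [Function.surjInv_eq])

/-- The defining formula `b_N (ρ x) (ρ y) = ∑ m, b (t ^ (m N) x) y`. -/
theorem bN_ρ (N : ℕ+) (x y : S) :
    P.bN N (ρ N x) (ρ N y) = ∑ᶠ m : ℤ, P.b ((T (m * N) : ℤ[T;T⁻¹]) • x) y :=
  P.bPre_congr N (Function.surjInv_eq _ _) (Function.surjInv_eq _ _)

theorem finite_support_half (N : ℕ+) (x y : S) : (Function.support fun m : ℕ =>
    P.b x ((T (((m : ℤ) + 1) * N) : ℤ[T;T⁻¹]) • y)).Finite := by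
  have h := P.finite_support_N N y x
  refine (Set.Finite.preimage (f := fun m : ℕ => (m : ℤ) + 1) (fun m _ m' _ h => ?_) h).subset ?_
  · simpa using h
  · intro m hm
    rw [Function.mem_support, P.symm] at hm
    exact hm

/-- The sum `∑ m > 0, b x (t ^ (m N) y)`, as a form on `S`. -/
def bHalf (N : ℕ+) : LinearMap.BilinMap ℤ S QZ :=
  bilinOfAdd (fun x y => ∑ᶠ m : ℕ, P.b x ((T (((m : ℤ) + 1) * N) : ℤ[T;T⁻¹]) • y))
    (fun x x' y => by
      simp only [map_add, LinearMap.add_apply]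
      exact finsum_add_distrib (P.finite_support_half N x y) (P.finite_support_half N x' y))
    (fun x y y' => by
      simp only [smul_add, map_add]
      exact finsum_add_distrib (P.finite_support_half N x y) (P.finite_support_half N x y'))

theorem finsum_nat_succ {A : Type*} [AddCommGroup A] (f : ℕ → A)
    (h : (Function.support fun m => f (m + 1)).Finite) :
    f 0 + ∑ᶠ m : ℕ, f (m + 1) = ∑ᶠ m : ℕ, f m := by
  obtain ⟨n, hn⟩ := h.bddAbove
  have h1 : (Function.support fun m => f (m + 1)) ⊆ (Finset.range (n + 1) : Finset ℕ) := by
    intro m hm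
    have := hn hm
    simp only [Finset.coe_range, Set.mem_Iio]
    omega
  have h2 : Function.support f ⊆ (Finset.range (n + 2) : Finset ℕ) := by
    intro m hm
    simp only [Finset.coe_range, Set.mem_Iio]
    rcases m with _ | m
    · omega
    · have := hn (show m ∈ Function.support fun m => f (m + 1) from hm)
      omega
  rw [finsum_eq_sum_of_support_subset _ h1, finsum_eq_sum_of_support_subset _ h2,
    Finset.sum_range_succ' f (n + 1), add_comm]

theorem bHalf_T_right (N : ℕ+) (x y : S) :
    P.b x ((T (N : ℤ) : ℤ[T;T⁻¹]) • y) + P.bHalf N x ((T (N : ℤ) : ℤ[T;T⁻¹]) • y) =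
      P.bHalf N x y := by
  have h := finsum_nat_succ (fun m : ℕ => P.b x ((T (((m : ℤ) + 1) * N) : ℤ[T;T⁻¹]) • y)) ?_
  · refine Eq.trans ?_ h
    congr 1
    · simp
    · refine finsum_congr fun m => ?_
      rw [← mul_smul, ← T_add]
      push_cast
      congr 3
      ring
  · exact (P.finite_support_half N x y).preimage (f := Nat.succ) (Nat.succ_injective.injOn)

theorem bHalf_T_left (N : ℕ+) (x y : S) :
    P.bHalf N ((T (N : ℤ) : ℤ[T;T⁻¹]) • x) y = P.b x y + P.bHalf N x y := by
  have h := finsum_nat_succ (fun m : ℕ => P.b x ((T ((m : ℤ) * N) : ℤ[T;T⁻¹]) • y)) ?_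
  · refine Eq.trans ?_ (h.symm.trans ?_)
    · refine finsum_congr fun m => ?_
      rw [add_mul, one_mul, add_comm, T_add, mul_smul, P.transl]
    · congr 1
      simp
  · simpa using P.finite_support_half N x y

end PTheory

namespace TheoryOfExcitations

variable (E : TheoryOfExcitations S)

/-- p-modularity is nondegeneracy of `θ`, that is, of its associated bilinear form. -/
def IsPModular : Prop := E.θ.polarBilin.Nondegenerate

/-- The quadratic form `θ x + ∑ m > 0, b x (t ^ (m N) x)` on `S`. -/
def θPre (N : ℕ+) : QuadraticMap ℤ S QZ := E.θ + (E.toPTheory.bHalf N).toQuadraticMap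

theorem θPre_polar (N : ℕ+) (x y : S) : QuadraticMap.polar (E.θPre N) x y =
    E.toPTheory.b x y + (E.toPTheory.bHalf N x y + E.toPTheory.bHalf N y x) := by
  have h : E.toPTheory.b x y = E.θ (x + y) - E.θ x - E.θ y := rfl
  rw [h]
  simp only [QuadraticMap.polar, θPre, add_apply, LinearMap.BilinMap.toQuadraticMap_apply,
    map_add, LinearMap.add_apply]
  abel

theorem θPre_T (N : ℕ+) (x : S) : E.θPre N ((T (N : ℤ) : ℤ[T;T⁻¹]) • x) = E.θPre N x := by
  simp only [θPre, add_apply, LinearMap.BilinMap.toQuadraticMap_apply, E.transl]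
  congr 1
  refine finsum_congr fun m => ?_
  rw [smul_comm, E.toPTheory.transl]

theorem θPre_polar_T (N : ℕ+) (x y : S) :
    QuadraticMap.polar (E.θPre N) x ((T (N : ℤ) : ℤ[T;T⁻¹]) • y) =
      QuadraticMap.polar (E.θPre N) x y := by
  rw [θPre_polar, θPre_polar, ← E.toPTheory.bHalf_T_right N x y, E.toPTheory.bHalf_T_left,
    E.toPTheory.symm y x]
  abel

theorem θPre_congr (N : ℕ+) {x x' : S} (hx : ρ N x = ρ N x') : E.θPre N x = E.θPre N x' := by
  obtain ⟨z, hz⟩ := (ρ_eq_iff N x x').1 hx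
  have hadd : ∀ u v : S, E.θPre N (u + v) =
      E.θPre N u + E.θPre N v + QuadraticMap.polar (E.θPre N) u v := fun u v => by
    simp only [QuadraticMap.polar]; abel
  have h1 : ∀ u : S, QuadraticMap.polar (E.θPre N) u (z - (T (N : ℤ) : ℤ[T;T⁻¹]) • z) = 0 :=
    fun u => by rw [QuadraticMap.polar_sub_right, θPre_polar_T, sub_self]
  have h2 : E.θPre N (z - (T (N : ℤ) : ℤ[T;T⁻¹]) • z) = 0 := by
    have h3 := hadd ((T (N : ℤ) : ℤ[T;T⁻¹]) • z) (z - (T (N : ℤ) : ℤ[T;T⁻¹]) • z)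
    rw [add_sub_cancel, h1, θPre_T, add_zero] at h3
    simpa using h3
  rw [sub_eq_iff_eq_add.1 hz, hadd, QuadraticMap.polar_comm, h1, h2, zero_add, add_zero]

theorem θPre_polar_congr (N : ℕ+) {x x' y y' : S} (hx : ρ N x = ρ N x') (hy : ρ N y = ρ N y') :
    QuadraticMap.polar (E.θPre N) x y = QuadraticMap.polar (E.θPre N) x' y' := by
  simp only [QuadraticMap.polar]
  rw [E.θPre_congr N hx, E.θPre_congr N hy,
    E.θPre_congr N (show ρ N (x + y) = ρ N (x' + y') by rw [map_add, map_add, hx, hy])]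

theorem θPre_polar_surjInv (N : ℕ+) (x y : Compact S N) :
    QuadraticMap.polar (fun x => E.θPre N (Function.surjInv (ρ_surjective N) x)) x y =
      QuadraticMap.polar (E.θPre N) (Function.surjInv (ρ_surjective N) x)
        (Function.surjInv (ρ_surjective N) y) := by
  simp only [QuadraticMap.polar]
  rw [E.θPre_congr N (x := Function.surjInv (ρ_surjective N) (x + y))]
  rw [map_add]
  simp only [Function.surjInv_eq]

/-- The quadratic form `θ_N` on `S_N`. -/
def θN (N : ℕ+) : QuadraticMap ℤ (Compact S N) QZ :=
  QuadraticMap.ofPolar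
    (fun x => E.θPre N (Function.surjInv (ρ_surjective N) x))
    (fun a x => by
      rw [← QuadraticMap.map_smul]
      refine E.θPre_congr N ?_
      rw [map_zsmul]
      simp only [Function.surjInv_eq])
    (fun x x' y => by
      rw [θPre_polar_surjInv, θPre_polar_surjInv, θPre_polar_surjInv,
        ← QuadraticMap.polar_add_left]
      refine E.θPre_polar_congr N ?_ rfl
      rw [map_add]
      simp only [Function.surjInv_eq])
    (fun a x y => by
      rw [θPre_polar_surjInv, θPre_polar_surjInv, ← QuadraticMap.polar_smul_left]
      refine E.θPre_polar_congr N ?_ rfl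
      rw [map_zsmul]
      simp only [Function.surjInv_eq])

/-- The defining formula `θ_N (ρ x) = θ x + ∑ m > 0, b x (t ^ (m N) x)`. -/
theorem θN_ρ (N : ℕ+) (x : S) : E.θN N (ρ N x) =
    E.θ x + ∑ᶠ m : ℕ, QuadraticMap.polar E.θ x ((T (((m : ℤ) + 1) * N) : ℤ[T;T⁻¹]) • x) :=
  E.θPre_congr N (Function.surjInv_eq _ _)

end TheoryOfExcitations

end

/-! ### Theories of abelian anyons -/

/-- `(A, b)` is a modular p-theory of abelian anyons: `A` is a finite abelian group and `b` is a
nondegenerate symmetric bilinear form with values in `ℚ/ℤ`. -/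
def IsModularAnyonPTheory (A : Type u) [AddCommGroup A] (b : LinearMap.BilinMap ℤ A QZ) : Prop :=
  Finite A ∧ (∀ x y, b x y = b y x) ∧ b.Nondegenerate

/-- `(A, θ)` is a modular theory of abelian anyons: `A` is a finite abelian group and `θ` is a
nondegenerate quadratic form with values in `ℚ/ℤ`. -/
def IsModularAnyonTheory (A : Type u) [AddCommGroup A] (θ : QuadraticMap ℤ A QZ) : Prop :=
  Finite A ∧ θ.polarBilin.Nondegenerate

end Planon

end

/-!
Write `R = ℤ[t, t⁻¹]` and `𝒬` for the Laurent polynomials over `ℚ/ℤ`. Every condition is compared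
with perfectness. Since `b` is nondegenerate, `Φ : S → S*` is injective, so perfectness says that
the cokernel of `Φ` vanishes.

*The cokernel.* The module `S` is finitely generated of finite exponent `n`, so `S*` embeds in a
power of the `n`-torsion of `𝒬`, a cyclic `R`-module; hence `S*` and the cokernel of `Φ` are
finitely generated. A nonzero finitely generated `R`-module of finite exponent has a simple
quotient, which is finite, and on which some `t ^ d` with `d > 0` acts trivially. So the cokernel
vanishes as soon as `1 - t ^ N` acts surjectively on it, that is, `S* = Φ(S) + (1 - t ^ N) S*`,
for all large `N` (`eq_top_of_one_sub_T_surjective`, `PTheory.imageΦ_eq_top`).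

*Infinite excitations.* The infinite excitations are identified with the characters of `S*`
through the pairing for which `φ` and `y ⊗ z` pair to the coefficient of `t ^ 0` in `φ(y) z`:
every character of `S*` is represented by an infinite excitation (`exists_pairExc_eq`), and only
by one (`eq_zero_of_pairExc`). Both facts follow from a finite presentation of `S`, the
injectivity of `ℚ/ℤ`, and the duality between the `n`-torsion of `𝒬` and the formal sums over
`ℤ / n`. In these terms `b̃(x, s)` is the value at `Φ x` of the character `s`, so nondegeneracy of `b̃`
on the right is surjectivity of `Φ`. The periodic excitations are the characters of the quotients
`S* / (1 - t ^ N) S*`, so nondegeneracy on the right over these gives `S* = Φ(S) + (1 - t ^ N) S*`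
for all `N`. Nondegeneracy on the left always holds: if `b x y ≠ 0`, then `x` pairs nontrivially
with `y ⊗ ∑ m, t ^ (m N)` for large `N`.

*Compactification.* Summing coefficients over the multiples of `N` sends `φ ∈ S*` to a character
of `S_N`, the one given by `b_N (ρ x)` if `φ = Φ x`, and the kernel of this map is
`(1 - t ^ N) S*` (`PTheory.exists_sub_T_smul_of_periodize`). If `Φ` is bijective, then `b_N (ρ x) = 0` thus
gives `Φ x ∈ (1 - t ^ N) Φ(S)`, so `ρ x = 0`. Conversely, if `b_N` is nondegenerate, it represents
every character of the finite group `S_N`, whence `S* = Φ(S) + (1 - t ^ N) S*`.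

For a theory of excitations, the bilinear form associated with `θ_N` is `b_N`.
-/

noncomputable section

namespace Planon

open LaurentPolynomial

/-! ### Characters with values in `ℚ/ℤ` -/

/-- Since `ℚ/ℤ` is injective, a character that kills the kernel of `D` factors through `D`, even
when `D` is not surjective. -/
theorem exists_character_comp {A B : Type*} [AddCommGroup A] [AddCommGroup B] (D : A →+ B)
    (f : A →+ QZ) (h : ∀ a, D a = 0 → f a = 0) : ∃ g : B →+ QZ, ∀ a, g (D a) = f a := by
  obtain ⟨g, hg⟩ := CharacterModule.dual_surjective_of_injective
    (QuotientAddGroup.kerLift D).toIntLinearMap (QuotientAddGroup.kerLift_injective D)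
    (QuotientAddGroup.lift D.ker f fun a ha => h a ha)
  exact ⟨g, fun a => DFunLike.congr_fun hg (a : A ⧸ D.ker)⟩

theorem exists_character_ne_zero {A : Type*} [AddCommGroup A] (H : AddSubgroup A) {a : A}
    (ha : a ∉ H) : ∃ ψ : A →+ QZ, (∀ x ∈ H, ψ x = 0) ∧ ψ a ≠ 0 := by
  have h : (a : A ⧸ H) ≠ 0 := fun h => ha ((QuotientAddGroup.eq_zero_iff a).1 h)
  obtain ⟨c, hc⟩ := CharacterModule.exists_character_apply_ne_zero_of_ne_zero h
  let c' : (A ⧸ H) →+ QZ := c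
  refine ⟨c'.comp (QuotientAddGroup.mk' H), fun x hx => ?_, hc⟩
  have h0 : QuotientAddGroup.mk' H x = 0 := (QuotientAddGroup.eq_zero_iff x).2 hx
  rw [AddMonoidHom.comp_apply, h0, map_zero]

/-- The class of `1 / n`, a generator of the `n`-torsion of `ℚ/ℤ`. -/
def invQZ (n : ℕ) : QZ := ((1 / n : ℚ) : QZ)

theorem nsmul_invQZ {n : ℕ} (hn : 0 < n) : n • invQZ n = 0 := by
  have h : (n : ℚ) ≠ 0 := by positivity
  rw [invQZ, ← AddCircle.coe_nsmul, nsmul_eq_mul, mul_one_div_cancel h, AddCircle.coe_period]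

theorem exists_zsmul_invQZ {n : ℕ} (hn : 0 < n) {x : QZ} (hx : n • x = 0) :
    ∃ a : ℤ, x = a • invQZ n := by
  obtain ⟨m, -, rfl⟩ := (AddCircle.nsmul_eq_zero_iff hn).1 hx
  refine ⟨m, ?_⟩
  rw [invQZ, ← AddCircle.coe_zsmul]
  congr 1
  simp [div_eq_mul_inv]

theorem dvd_of_zsmul_invQZ {n : ℕ} (hn : 0 < n) {a : ℤ} (h : a • invQZ n = 0) : (n : ℤ) ∣ a := by
  have h0 : (n : ℚ) ≠ 0 := by positivity
  rw [invQZ, ← AddCircle.coe_zsmul, AddCircle.coe_eq_zero_iff] at h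
  obtain ⟨k, hk⟩ := h
  refine ⟨k, ?_⟩
  simp only [zsmul_eq_mul, mul_one] at hk
  field_simp at hk
  rw [mul_comm]
  exact_mod_cast hk.symm

/-- On the `n`-torsion of `ℚ/ℤ`, which is cyclic, every character is multiplication by an
integer. -/
theorem exists_zsmul_of_torsion {n : ℕ} (hn : 0 < n) (h : QZ →+ QZ) :
    ∃ a : ℤ, ∀ x, n • x = 0 → h x = a • x := by
  obtain ⟨a, ha⟩ := exists_zsmul_invQZ hn (x := h (invQZ n))
    (by rw [← map_nsmul, nsmul_invQZ hn, map_zero])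
  refine ⟨a, fun x hx => ?_⟩
  obtain ⟨c, rfl⟩ := exists_zsmul_invQZ hn hx
  rw [map_zsmul, ha, smul_comm]

theorem exists_zsmul_pi_of_torsion {ι : Type*} [Fintype ι] {n : ℕ} (hn : 0 < n)
    (h : (ι → QZ) →+ QZ) : ∃ a : ι → ℤ, ∀ q, n • q = 0 → h q = ∑ i, a i • q i := by
  classical
  choose a ha using fun i =>
    exists_zsmul_of_torsion hn (h.comp (AddMonoidHom.single (fun _ => QZ) i))
  refine ⟨a, fun q hq => ?_⟩
  conv_lhs => rw [← Finset.univ_sum_single q]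
  rw [map_sum]
  exact Finset.sum_congr rfl fun i _ => ha i (q i) (congrFun hq i)

/-- A pairing of a finite group with an abelian group that separates the points of the finite
group represents every character of it: a character extends from the group to its embedding in a
power of `ℚ/ℤ`, and there it is an integral combination of the coordinates. -/
theorem exists_eq_of_separating {A : Type*} [AddCommGroup A] [Finite A]
    (b : LinearMap.BilinMap ℤ A QZ) (hb : b.SeparatingRight) (f : A →+ QZ) :
    ∃ x, ∀ y, b x y = f y := by
  have := Fintype.ofFinite A
  let D : A →+ (A → QZ) := AddMonoidHom.pi fun x => (b x).toAddMonoidHom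
  obtain ⟨g, hg⟩ := exists_character_comp D f fun a ha => by
    rw [hb a fun x => congrFun ha x, map_zero]
  obtain ⟨c, hc⟩ := exists_zsmul_pi_of_torsion (Nat.card_pos (α := A)) g
  refine ⟨∑ x, c x • x, fun y => ?_⟩
  rw [← hg, hc _ (by rw [← map_nsmul, card_nsmul_eq_zero', map_zero])]
  simp only [map_sum, map_smul, LinearMap.sum_apply, LinearMap.smul_apply]
  rfl

/-! ### Modules on which almost all `1 - t ^ N` are surjective -/

instance : IsNoetherianRing ℤ[T;T⁻¹] :=
  IsLocalization.isNoetherianRing (Submonoid.powers (Polynomial.X : Polynomial ℤ)) _ inferInstance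

/-- The residue fields of `ℤ[t, t⁻¹]` of positive characteristic are finite, so that `t` has finite
order in each. -/
theorem exists_one_sub_T_mem (I : Ideal ℤ[T;T⁻¹]) [hI : I.IsMaximal] {n : ℕ} (hn : 0 < n)
    (hnI : (n : ℤ[T;T⁻¹]) ∈ I) : ∃ d : ℕ, 0 < d ∧ (1 - T (d : ℤ) : ℤ[T;T⁻¹]) ∈ I := by
  let _ := Ideal.Quotient.field I
  obtain ⟨p, hp⟩ := CharP.exists (ℤ[T;T⁻¹] ⧸ I)
  have hp0 : p ≠ 0 := by
    rintro rfl
    have h : ((n : ℕ) : ℤ[T;T⁻¹] ⧸ I) = 0 := by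
      rw [← map_natCast (Ideal.Quotient.mk I), Ideal.Quotient.eq_zero_iff_mem]
      exact hnI
    exact hn.ne' (Nat.eq_zero_of_zero_dvd ((CharP.cast_eq_zero_iff (ℤ[T;T⁻¹] ⧸ I) 0 n).1 h))
  have hpp : Fact p.Prime := ⟨(CharP.char_is_prime_or_zero (ℤ[T;T⁻¹] ⧸ I) p).resolve_right hp0⟩
  let _ := ZMod.algebra (ℤ[T;T⁻¹] ⧸ I) p
  have hft : Algebra.FiniteType ℤ (ℤ[T;T⁻¹] ⧸ I) :=
    Algebra.FiniteType.of_surjective (Ideal.Quotient.mkₐ ℤ I) Ideal.Quotient.mk_surjective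
  have hft' : Algebra.FiniteType (ZMod p) (ℤ[T;T⁻¹] ⧸ I) :=
    Algebra.FiniteType.of_restrictScalars_finiteType ℤ _ _
  have hfin : Module.Finite (ZMod p) (ℤ[T;T⁻¹] ⧸ I) := finite_of_finite_type_of_isJacobsonRing _ _
  have : Finite (ℤ[T;T⁻¹] ⧸ I) := Module.finite_of_finite (ZMod p)
  have hu : IsUnit (Ideal.Quotient.mk I (T 1)) := (isUnit_T 1).map _
  refine ⟨orderOf hu.unit, orderOf_pos _, ?_⟩
  rw [← Ideal.Quotient.eq_zero_iff_mem, map_sub, sub_eq_zero, map_one]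
  have h := congrArg Units.val (pow_orderOf_eq_one hu.unit)
  rw [Units.val_pow_eq_pow_val, IsUnit.unit_spec, ← map_pow, T_pow, mul_one] at h
  exact h.symm

/-- A finitely generated module of finite exponent on which multiplication by `1 - t ^ N` is
surjective for all large `N` vanishes: otherwise it has a simple quotient, on which some `t ^ d`
acts trivially. -/
theorem subsingleton_of_one_sub_T_surjective {M : Type*} [AddCommGroup M] [Module ℤ[T;T⁻¹] M]
    [Module.Finite ℤ[T;T⁻¹] M] {n : ℕ} (hn : 0 < n) (hM : ∀ x : M, n • x = 0) (N₀ : ℕ+)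
    (h : ∀ N : ℕ+, N₀ ≤ N → ∀ x : M, ∃ y : M, x = y - (T (N : ℤ) : ℤ[T;T⁻¹]) • y) :
    Subsingleton M := by
  by_contra hsub
  rw [not_subsingleton_iff_nontrivial] at hsub
  obtain h0 | ⟨V, hV, -⟩ := IsCoatomic.eq_top_or_exists_le_coatom (⊥ : Submodule ℤ[T;T⁻¹] M)
  · exact bot_ne_top h0
  have : IsSimpleModule ℤ[T;T⁻¹] (M ⧸ V) := isSimpleModule_iff_isCoatom.2 hV
  obtain ⟨I, hI, ⟨e⟩⟩ := isSimpleModule_iff_quot_maximal.1 this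
  have hnI : (n : ℤ[T;T⁻¹]) ∈ I := by
    obtain ⟨z, hz⟩ := e.surjective (Ideal.Quotient.mk I 1)
    obtain ⟨x, rfl⟩ := V.mkQ_surjective z
    have h1 := congrArg (n • ·) hz
    simp only [← map_nsmul, hM, map_zero, nsmul_one] at h1
    exact Ideal.Quotient.eq_zero_iff_mem.1 h1.symm
  obtain ⟨d, hd, hdI⟩ := exists_one_sub_T_mem I hn hnI
  have hker : ∀ r ∈ I, ∀ x : M ⧸ V, r • x = 0 := fun r hr x => by
    apply e.injective
    rw [map_smul, map_zero]
    obtain ⟨s, hs⟩ := Ideal.Quotient.mk_surjective (e x)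
    rw [← hs, ← Ideal.Quotient.mk_eq_mk, ← Submodule.Quotient.mk_smul,
      Submodule.Quotient.mk_eq_zero]
    exact I.mul_mem_right s hr
  have hT : ∀ k : ℕ, (1 - T ((k * d : ℕ) : ℤ) : ℤ[T;T⁻¹]) ∈ I := fun k => by
    have h1 : (1 - T (d : ℤ) : ℤ[T;T⁻¹]) ∣ 1 ^ k - T (d : ℤ) ^ k := sub_dvd_pow_sub_pow _ _ _
    rw [one_pow, T_pow] at h1
    push_cast
    exact I.mem_of_dvd h1 hdI
  have : Nontrivial (M ⧸ V) := IsSimpleModule.nontrivial ℤ[T;T⁻¹] _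
  obtain ⟨x, hx⟩ := exists_ne (0 : M ⧸ V)
  obtain ⟨x, rfl⟩ := V.mkQ_surjective x
  -- A multiple of `d` that is at least `N₀`.
  obtain ⟨y, rfl⟩ := h (N₀ * ⟨d, hd⟩) (le_mul_of_one_le_right' one_le) x
  refine hx ?_
  have h2 := hker _ (hT N₀) (V.mkQ y)
  rw [sub_smul, one_smul, ← map_smul, ← map_sub] at h2
  exact h2

theorem eq_top_of_one_sub_T_surjective {M : Type*} [AddCommGroup M] [Module ℤ[T;T⁻¹] M]
    [Module.Finite ℤ[T;T⁻¹] M] (V : Submodule ℤ[T;T⁻¹] M) {n : ℕ} (hn : 0 < n)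
    (hM : ∀ x : M, n • x = 0) (N₀ : ℕ+)
    (h : ∀ N : ℕ+, N₀ ≤ N → ∀ x : M, ∃ y : M, x - (y - (T (N : ℤ) : ℤ[T;T⁻¹]) • y) ∈ V) :
    V = ⊤ := by
  rw [← Submodule.Quotient.subsingleton_iff]
  refine subsingleton_of_one_sub_T_surjective hn (fun c => ?_) N₀ fun N hN c => ?_
  · obtain ⟨x, rfl⟩ := V.mkQ_surjective c
    rw [← map_nsmul, hM, map_zero]
  · obtain ⟨x, rfl⟩ := V.mkQ_surjective c
    obtain ⟨y, hy⟩ := h N hN x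
    exact ⟨V.mkQ y, (Submodule.Quotient.eq V).2 hy⟩

/-- A finitely generated torsion module on which `t ^ N` acts trivially is finite. -/
theorem finite_of_T_smul {M : Type*} [AddCommGroup M] [Module ℤ[T;T⁻¹] M]
    [Module.Finite ℤ[T;T⁻¹] M] (htors : ∀ x : M, ∃ m : ℕ, 0 < m ∧ m • x = 0) (N : ℕ+)
    (h : ∀ x : M, (T (N : ℤ) : ℤ[T;T⁻¹]) • x = x) : Finite M := by
  obtain ⟨E, hE⟩ := Module.Finite.fg_top (R := ℤ[T;T⁻¹]) (M := M)
  let F : Set M := Set.image2 (fun (i : ℤ) (e : M) => (T i : ℤ[T;T⁻¹]) • e) (Set.Ico 0 (N : ℤ)) E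
  have hF : F.Finite := (Set.finite_Ico _ _).image2 _ E.finite_toSet
  have hmul : ∀ (k : ℤ) (x : M), (T (k * N) : ℤ[T;T⁻¹]) • x = x := by
    intro k x
    induction k with
    | zero => simp
    | succ k ih => rw [add_mul, one_mul, T_add, mul_smul, h, ih]
    | pred k ih =>
      conv_lhs => rw [← h x]
      rw [← mul_smul, ← T_add, sub_mul, one_mul, sub_add_cancel, ih]
  have hT : ∀ (k : ℤ), ∀ e ∈ E, (T k : ℤ[T;T⁻¹]) • e ∈ F := fun k e he => by
    refine ⟨k % N, ⟨Int.emod_nonneg _ (by simp), Int.emod_lt_of_pos _ (by simp)⟩, e, he, ?_⟩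
    conv_rhs => rw [← Int.emod_add_ediv_mul k N, T_add, mul_smul, hmul]
  have hsm : ∀ (r : ℤ[T;T⁻¹]), ∀ e ∈ E, r • e ∈ Submodule.span ℤ F := fun r e he => by
    induction r using LaurentPolynomial.induction_on' with
    | add p q hp hq => rw [add_smul]; exact add_mem hp hq
    | C_mul_T n a =>
      rw [mul_smul, C_smul]
      exact Submodule.smul_mem _ _ (Submodule.subset_span (hT n e he))
  have htop : Submodule.span ℤ F = ⊤ := by
    refine eq_top_iff.2 fun x _ => ?_
    have hx : x ∈ Submodule.span ℤ[T;T⁻¹] (E : Set M) := hE ▸ Submodule.mem_top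
    obtain ⟨c, rfl⟩ := Submodule.mem_span_finset'.1 hx
    exact sum_mem fun e _ => hsm _ _ e.2
  have : Module.Finite ℤ M := ⟨⟨hF.toFinset, by rw [hF.coe_toFinset, htop]⟩⟩
  refine Module.finite_of_fg_torsion M fun {x} => ?_
  obtain ⟨m, hm, hx⟩ := htors x
  refine ⟨⟨m, mem_nonZeroDivisors_of_ne_zero (by exact_mod_cast hm.ne')⟩, ?_⟩
  rw [Submonoid.mk_smul, natCast_zsmul, hx]

/-! ### Laurent polynomials over `ℚ/ℤ` -/

/-- The monomial `a t ^ i`. -/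
def monomial (i : ℤ) : QZ →+ LaurentSum QZ where
  toFun a := ⟨(Pi.single i a : ℤ → QZ), by
    refine (Set.finite_singleton i).subset fun m hm => ?_
    by_contra h
    exact hm (Pi.single_eq_of_ne (M := fun _ : ℤ => QZ) h a)⟩
  map_zero' := Subtype.ext (Pi.single_zero i)
  map_add' a b := Subtype.ext (Pi.single_add (f := fun _ : ℤ => QZ) i a b)

/-- The coefficient of `t ^ m`. -/
def coeff (m : ℤ) : LaurentSum QZ →+ QZ where
  toFun q := q.1 m
  map_zero' := rfl
  map_add' _ _ := rfl

theorem coeff_apply (m : ℤ) (q : LaurentSum QZ) : coeff m q = q.1 m := rfl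

theorem coeff_monomial (m i : ℤ) (a : QZ) : coeff m (monomial i a) = if m = i then a else 0 := by
  change (Pi.single i a : ℤ → QZ) m = _
  rw [Pi.single_apply]

theorem coeff_ext {p q : LaurentSum QZ} (h : ∀ m, coeff m p = coeff m q) : p = q :=
  Subtype.ext (funext h)

theorem coeff_T_smul (k m : ℤ) (q : LaurentSum QZ) :
    coeff m ((T k : ℤ[T;T⁻¹]) • q) = coeff (m - k) q := by
  rw [coeff_apply, Submodule.coe_smul, T_smul_formalSum]; rfl

theorem finite_support_coeff (q : LaurentSum QZ) : (Function.support fun m => coeff m q).Finite :=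
  q.2

theorem sum_monomial (q : LaurentSum QZ) :
    ∑ i ∈ (finite_support_coeff q).toFinset, monomial i (coeff i q) = q := by
  refine coeff_ext fun m => ?_
  simp only [map_sum, coeff_monomial, Finset.sum_ite_eq]
  split_ifs with h
  · rfl
  · simpa [eq_comm] using h

theorem mulFormal_monomial (i : ℤ) (a : QZ) (z : FormalSum ℤ) :
    mulFormal (monomial i a) z 0 = z (-i) • a := by
  refine (finsum_eq_single _ i fun j hj => ?_).trans ?_
  · change z (0 - j) • coeff j (monomial i a) = 0
    rw [coeff_monomial, if_neg hj, smul_zero]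
  · change z (0 - i) • coeff i (monomial i a) = _
    rw [coeff_monomial, if_pos rfl, zero_sub]

/-- The coefficient of `t ^ 0` in the product `q z`, as a biadditive pairing. -/
def pairZero : LaurentSum QZ →+ FormalSum ℤ →+ QZ :=
  AddMonoidHom.mk' (fun q => AddMonoidHom.mk' (fun z => mulFormalHom q z 0)
    (fun z w => by rw [map_add]; rfl)) (fun p q => by ext z; simp only [map_add]; rfl)

theorem pairZero_apply (q : LaurentSum QZ) (z : FormalSum ℤ) :
    pairZero q z = mulFormalHom q z 0 := rfl

theorem pairZero_monomial (i : ℤ) (a : QZ) (z : FormalSum ℤ) :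
    pairZero (monomial i a) z = z (-i) • a := mulFormal_monomial i a z

theorem pairZero_smul (r : ℤ[T;T⁻¹]) (q : LaurentSum QZ) (z : FormalSum ℤ) :
    pairZero (r • q) z = pairZero q (r • z) := by
  rw [pairZero_apply, pairZero_apply, map_smul, map_smul, LinearMap.smul_apply]

/-- On the `n`-torsion of the Laurent polynomials over `ℚ/ℤ`, every character is the pairing with
an integral formal sum. -/
theorem exists_formalSum_of_torsion {n : ℕ} (hn : 0 < n) (g : LaurentSum QZ →+ QZ) :
    ∃ w : FormalSum ℤ, ∀ q, n • q = 0 → g q = pairZero q w := by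
  choose a ha using fun i : ℤ => exists_zsmul_of_torsion hn (g.comp (monomial i))
  obtain ⟨w, hw⟩ : ∃ w : FormalSum ℤ, ∀ i, w (-i) = a i :=
    ⟨fun i => a (-i), fun i => congrArg a (neg_neg i)⟩
  refine ⟨w, fun q hq => ?_⟩
  conv_lhs => rw [← sum_monomial q]
  conv_rhs => rw [← sum_monomial q]
  rw [map_sum, map_sum, AddMonoidHom.finsetSum_apply]
  refine Finset.sum_congr rfl fun i _ => ?_
  rw [pairZero_monomial, hw]
  exact ha i (coeff i q) (by rw [← map_nsmul, hq, map_zero])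

theorem exists_formalSum_pi_of_torsion {ι : Type*} [Fintype ι] {n : ℕ} (hn : 0 < n)
    (g : (ι → LaurentSum QZ) →+ QZ) :
    ∃ w : ι → FormalSum ℤ, ∀ q, n • q = 0 → g q = ∑ i, pairZero (q i) (w i) := by
  classical
  choose w hw using fun i =>
    exists_formalSum_of_torsion hn (g.comp (AddMonoidHom.single (fun _ => LaurentSum QZ) i))
  refine ⟨w, fun q hq => ?_⟩
  conv_lhs => rw [← Finset.univ_sum_single q]
  rw [map_sum]
  exact Finset.sum_congr rfl fun i _ => hw i (q i) (congrFun hq i)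

/-- The annihilator of the `n`-torsion consists of the multiples of `n`. -/
theorem exists_eq_nsmul_of_pairZero {n : ℕ} (hn : 0 < n) (z : FormalSum ℤ)
    (h : ∀ q, n • q = 0 → pairZero q z = 0) : ∃ v : FormalSum ℤ, z = n • v := by
  have hd : ∀ m, (n : ℤ) ∣ z m := fun m => dvd_of_zsmul_invQZ hn (by
    have h1 := h (monomial (-m) (invQZ n)) (by rw [← map_nsmul, nsmul_invQZ hn, map_zero])
    rwa [pairZero_monomial, neg_neg] at h1)
  choose v hv using hd
  refine ⟨v, funext fun m => ?_⟩
  change z m = n • v m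
  rw [hv m, nsmul_eq_mul]

/-- The `n`-torsion is the cyclic module generated by `1 / n`. -/
theorem mem_span_of_torsion {n : ℕ} (hn : 0 < n) (q : LaurentSum QZ) (hq : n • q = 0) :
    q ∈ Submodule.span ℤ[T;T⁻¹] {monomial 0 (invQZ n)} := by
  rw [← sum_monomial q]
  refine sum_mem fun i _ => ?_
  obtain ⟨a, ha⟩ := exists_zsmul_invQZ hn (x := coeff i q) (by rw [← map_nsmul, hq, map_zero])
  have h : monomial i (coeff i q) = (C a * T i : ℤ[T;T⁻¹]) • monomial 0 (invQZ n) := by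
    refine coeff_ext fun m => ?_
    rw [mul_smul, C_smul, map_zsmul, coeff_T_smul, coeff_monomial, coeff_monomial, ha]
    simp only [sub_eq_zero]
    split_ifs <;> simp
  rw [h]
  exact Submodule.smul_mem _ _ (Submodule.mem_span_singleton_self _)

/-! ### Division by `1 - t ^ N` -/

theorem eq_zero_of_T_smul_eq (N : ℕ+) (q : LaurentSum QZ)
    (h : (T (N : ℤ) : ℤ[T;T⁻¹]) • q = q) : q = 0 := by
  by_contra hq
  obtain ⟨m, hm⟩ : ∃ m, coeff m q ≠ 0 := by
    by_contra! h0
    exact hq (coeff_ext fun m => by rw [h0, map_zero])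
  have hk : ∀ k : ℕ, coeff (m + k * N) q = coeff m q := fun k => by
    induction k with
    | zero => simp
    | succ k ih =>
      rw [← ih]
      conv_lhs => rw [← h]
      rw [coeff_T_smul]
      congr 2
      push_cast
      ring
  refine Set.infinite_of_injective_forall_mem (f := fun k : ℕ => m + k * (N : ℤ))
    (fun k l hkl => ?_) (fun k => ?_) (finite_support_coeff q)
  · simpa using hkl
  · simpa [hk k] using hm

theorem finsum_int_eq_finsum_nat {A : Type*} [AddCommGroup A] (f : ℤ → A)
    (h : ∀ j : ℤ, j < 0 → f j = 0) : ∑ᶠ j : ℤ, f j = ∑ᶠ j : ℕ, f j := by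
  rw [← finsum_mem_range (f := f) (g := fun j : ℕ => (j : ℤ)) Nat.cast_injective, finsum_mem_def]
  refine finsum_congr fun j => (Set.indicator_apply_eq_self.2 fun hj => ?_).symm
  refine h j (lt_of_not_ge fun h0 => hj ⟨j.toNat, Int.toNat_of_nonneg h0⟩)

theorem finite_support_residue (N : ℕ+) (q : LaurentSum QZ) (k : ℤ) :
    (Function.support fun j : ℤ => coeff (k + j * N) q).Finite := by
  refine Set.Finite.preimage (f := fun j : ℤ => k + j * (N : ℤ)) (fun i _ j _ hij => ?_)
    (finite_support_coeff q)
  simpa using hij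

/-- A Laurent polynomial is divisible by `1 - t ^ N` if its coefficients sum to zero over each
residue class modulo `N`; the coefficients of the quotient are the partial sums. -/
theorem exists_sub_T_smul (N : ℕ+) (q : LaurentSum QZ)
    (h : ∀ k : ℤ, ∑ᶠ j : ℤ, coeff (k + j * N) q = 0) :
    ∃ p : LaurentSum QZ, q = p - (T (N : ℤ) : ℤ[T;T⁻¹]) • p := by
  have hfin : ∀ k : ℤ, (Function.support fun j : ℕ => coeff (k - j * N) q).Finite := fun k => by
    refine Set.Finite.preimage (f := fun j : ℕ => k - j * (N : ℤ)) (fun i _ j _ hij => ?_)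
      (finite_support_coeff q)
    simpa using hij
  obtain ⟨L, hL⟩ := (finite_support_coeff q).bddBelow
  obtain ⟨U, hU⟩ := (finite_support_coeff q).bddAbove
  have hN : (0 : ℤ) < N := by simp
  let p : LaurentSum QZ := ⟨fun m => ∑ᶠ j : ℕ, coeff (m - j * N) q, by
    refine (Set.finite_Icc L U).subset fun m hm => ?_
    by_contra hm'
    refine hm ?_
    rw [Set.mem_Icc, not_and_or, not_le, not_le] at hm'
    have hzero : ∀ i : ℤ, i < L ∨ U < i → coeff i q = 0 := fun i hi => by
      by_contra h0
      have := hL h0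
      have := hU h0
      omega
    obtain hm' | hm' := hm'
    · refine (finsum_congr fun j : ℕ => hzero _ (Or.inl ?_)).trans finsum_zero
      have : 0 ≤ (j : ℤ) * N := by positivity
      omega
    -- Above the support of `q`, a partial sum is the sum over the whole residue class.
    · rw [← h m, ← finsum_comp_equiv (Equiv.neg ℤ)]
      refine Eq.trans ?_ (finsum_int_eq_finsum_nat _ fun j hj => hzero _ (Or.inr ?_)).symm
      · refine finsum_congr fun j => ?_
        rw [Equiv.neg_apply, neg_mul, sub_eq_add_neg]
      · have : 0 ≤ -j * (N : ℤ) := mul_nonneg (by omega) hN.le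
        rw [Equiv.neg_apply]
        omega⟩
  refine ⟨p, coeff_ext fun m => ?_⟩
  rw [map_sub, coeff_T_smul, eq_sub_iff_add_eq]
  have h1 := PTheory.finsum_nat_succ (fun j : ℕ => coeff (m - j * N) q)
    ((hfin m).preimage Nat.succ_injective.injOn)
  refine Eq.trans ?_ h1
  congr 1
  · simp
  · refine finsum_congr fun j : ℕ => ?_
    congr 2
    push_cast
    ring

universe u

variable {S : Type u} [AddCommGroup S] [Module ℤ[T;T⁻¹] S]

/-! ### Duality between `S*` and the infinite excitations -/

theorem IsFusionTheory.exists_exponent (h : IsFusionTheory S) :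
    ∃ n : ℕ, 0 < n ∧ ∀ x : S, n • x = 0 := by
  have := h.fg
  obtain ⟨k, f, hf⟩ := Module.Finite.exists_fin' ℤ[T;T⁻¹] S
  choose m hm0 hm using fun i : Fin k => h.finite_order (f (Pi.single i 1))
  refine ⟨∏ i, m i, Finset.prod_pos fun i _ => hm0 i, fun x => ?_⟩
  obtain ⟨r, rfl⟩ := hf x
  rw [pi_eq_sum_univ' r, map_sum, Finset.smul_sum]
  refine Finset.sum_eq_zero fun i _ => ?_
  obtain ⟨c, hc⟩ := Finset.dvd_prod_of_mem m (Finset.mem_univ i)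
  rw [map_smul, hc, mul_comm, mul_smul, smul_comm (m i) (r i), hm, smul_zero, smul_zero]

/-- The map that sends `y ⊗ z` to the product `φ(y) z`. -/
def extendTensor (φ : S →ₗ[ℤ[T;T⁻¹]] LaurentSum QZ) :
    S ⊗[ℤ[T;T⁻¹]] FormalSum ℤ →ₗ[ℤ[T;T⁻¹]] FormalSum QZ :=
  TensorProduct.lift (mulFormalHom ∘ₗ φ)

/-- The canonical pairing of a homomorphism `φ` from `S` to the Laurent polynomials over `ℚ/ℤ`
with an infinite excitation: the pairing with `y ⊗ z` is the coefficient of `t ^ 0` in `φ(y) z`. -/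
def pairExc : (S →ₗ[ℤ[T;T⁻¹]] LaurentSum QZ) →+ (S ⊗[ℤ[T;T⁻¹]] FormalSum ℤ) →+ QZ :=
  AddMonoidHom.mk' (fun φ => AddMonoidHom.mk' (fun s => extendTensor φ s 0)
    (fun s s' => by rw [map_add]; rfl))
    (fun φ φ' => by
      ext s
      change extendTensor (φ + φ') s 0 = (extendTensor φ s + extendTensor φ' s) 0
      have h : extendTensor (φ + φ') = extendTensor φ + extendTensor φ' := by
        unfold extendTensor
        rw [LinearMap.comp_add]
        exact map_add (TensorProduct.lift.equiv (RingHom.id ℤ[T;T⁻¹]) S (FormalSum ℤ)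
          (FormalSum QZ)) _ _
      rw [h]
      rfl)

theorem pairExc_tmul (φ : S →ₗ[ℤ[T;T⁻¹]] LaurentSum QZ) (y : S) (z : FormalSum ℤ) :
    pairExc φ (y ⊗ₜ z) = pairZero (φ y) z := rfl

theorem pairExc_smul (r : ℤ[T;T⁻¹]) (φ : S →ₗ[ℤ[T;T⁻¹]] LaurentSum QZ)
    (s : S ⊗[ℤ[T;T⁻¹]] FormalSum ℤ) : pairExc φ (r • s) = pairExc (r • φ) s := by
  induction s with
  | zero => simp
  | add s s' h h' => rw [smul_add, map_add, map_add, h, h']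
  | tmul y z =>
    rw [TensorProduct.smul_tmul', pairExc_tmul, pairExc_tmul, map_smul, LinearMap.smul_apply]

theorem exists_eq_sum_tmul {k : ℕ} (f : (Fin k → ℤ[T;T⁻¹]) →ₗ[ℤ[T;T⁻¹]] S)
    (hf : Function.Surjective f) (s : S ⊗[ℤ[T;T⁻¹]] FormalSum ℤ) :
    ∃ z : Fin k → FormalSum ℤ, s = ∑ i, f (Pi.single i 1) ⊗ₜ z i := by
  induction s with
  | zero => exact ⟨0, by simp⟩
  | add s s' h h' =>
    obtain ⟨z, rfl⟩ := h
    obtain ⟨z', rfl⟩ := h'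
    exact ⟨z + z', by simp [TensorProduct.tmul_add, Finset.sum_add_distrib]⟩
  | tmul y z =>
    obtain ⟨r, rfl⟩ := hf y
    refine ⟨fun i => r i • z, ?_⟩
    conv_lhs => rw [← Finset.univ_sum_single r]
    rw [map_sum, TensorProduct.sum_tmul]
    refine Finset.sum_congr rfl fun i _ => ?_
    rw [← TensorProduct.smul_tmul, ← map_smul, ← Pi.single_smul, smul_eq_mul, mul_one]

/-- The evaluation of homomorphisms at finitely many generators is injective, so that characters
of `S*` extend to a power of the module of Laurent polynomials over `ℚ/ℤ`. -/
theorem exists_pairExc_eq (hS : IsFusionTheory S)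
    (ψ : (S →ₗ[ℤ[T;T⁻¹]] LaurentSum QZ) →+ QZ) :
    ∃ s : S ⊗[ℤ[T;T⁻¹]] FormalSum ℤ, ∀ φ, pairExc φ s = ψ φ := by
  have := hS.fg
  obtain ⟨k, f, hf⟩ := Module.Finite.exists_fin' ℤ[T;T⁻¹] S
  obtain ⟨n, hn, hnS⟩ := hS.exists_exponent
  let D : (S →ₗ[ℤ[T;T⁻¹]] LaurentSum QZ) →+ (Fin k → LaurentSum QZ) :=
    AddMonoidHom.mk' (fun φ i => φ (f (Pi.single i 1))) fun _ _ => rfl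
  obtain ⟨g, hg⟩ := exists_character_comp (A := S →ₗ[ℤ[T;T⁻¹]] LaurentSum QZ) D ψ fun φ hφ => by
    have h0 : φ ∘ₗ f = 0 := LinearMap.pi_ext' fun i => LinearMap.ext_ring (congrFun hφ i)
    have h1 : φ = 0 := LinearMap.ext fun x => by
      obtain ⟨r, rfl⟩ := hf x
      exact LinearMap.congr_fun h0 r
    rw [h1, map_zero]
  obtain ⟨w, hw⟩ := exists_formalSum_pi_of_torsion hn g
  refine ⟨∑ i, f (Pi.single i 1) ⊗ₜ w i, fun φ => ?_⟩
  rw [← hg, hw, map_sum]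
  · rfl
  · rw [← map_nsmul]
    refine funext fun i => ?_
    change (n • φ) (f (Pi.single i 1)) = 0
    rw [LinearMap.smul_apply, ← map_nsmul, hnS, map_zero]

/-- The pairing of `S*` with the infinite excitations separates the latter. With generators
`e i` of `S` and generators of their relations, `S*` is the kernel of a map between powers of the
module of Laurent polynomials over `ℚ/ℤ`; a character that vanishes on it factors through this map,
which exhibits the infinite excitation as a combination of relations. The torsion of `S` is among
the relations, which makes all characters in sight integral formal sums. -/
theorem eq_zero_of_pairExc (hS : IsFusionTheory S) (s : S ⊗[ℤ[T;T⁻¹]] FormalSum ℤ)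
    (hs : ∀ φ : S →ₗ[ℤ[T;T⁻¹]] LaurentSum QZ, pairExc φ s = 0) : s = 0 := by
  have := hS.fg
  obtain ⟨k, f, hf⟩ := Module.Finite.exists_fin' ℤ[T;T⁻¹] S
  obtain ⟨n, hn, hnS⟩ := hS.exists_exponent
  obtain ⟨m, κ', hκ'⟩ := Module.Finite.exists_fin' ℤ[T;T⁻¹] (LinearMap.ker f)
  let κ : Fin m → Fin k → ℤ[T;T⁻¹] := fun j => κ' (Pi.single j 1)
  have hκ : ∀ j, f (κ j) = 0 := fun j => (κ' (Pi.single j 1)).2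
  obtain ⟨z, rfl⟩ := exists_eq_sum_tmul f hf s
  let F : (Fin k → LaurentSum QZ) →+ QZ :=
    AddMonoidHom.mk' (fun q => ∑ i, pairZero (q i) (z i)) fun p q => by
      simp only [Pi.add_apply, map_add, AddMonoidHom.add_apply, Finset.sum_add_distrib]
  let D : (Fin k → LaurentSum QZ) →+ (Fin m → LaurentSum QZ) :=
    AddMonoidHom.mk' (fun q j => ∑ i, κ j i • q i) fun p q => by
      ext1 j
      simp only [Pi.add_apply, smul_add, Finset.sum_add_distrib]
  obtain ⟨g, hg⟩ := exists_character_comp D F fun q hq => by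
    -- A solution `q` of the relations is a homomorphism from `S`.
    let l := Fintype.linearCombination ℤ[T;T⁻¹] q
    have hl0 : ((l ∘ₗ (LinearMap.ker f).subtype) ∘ₗ κ') = 0 :=
      LinearMap.pi_ext' fun j => LinearMap.ext_ring (congrFun hq j)
    have hl : LinearMap.ker f ≤ LinearMap.ker l := fun r hr => by
      obtain ⟨c, hc⟩ := hκ' ⟨r, hr⟩
      have h1 := LinearMap.congr_fun hl0 c
      rw [LinearMap.comp_apply, hc] at h1
      exact h1
    let φ : S →ₗ[ℤ[T;T⁻¹]] LaurentSum QZ :=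
      (LinearMap.ker f).liftQ l hl ∘ₗ (f.quotKerEquivOfSurjective hf).symm.toLinearMap
    have hφ : ∀ i, φ (f (Pi.single i 1)) = q i := fun i => by
      have h1 : (f.quotKerEquivOfSurjective hf).symm (f (Pi.single i 1)) =
          (LinearMap.ker f).mkQ (Pi.single i 1) := by
        rw [LinearEquiv.symm_apply_eq]; rfl
      change (LinearMap.ker f).liftQ l hl ((f.quotKerEquivOfSurjective hf).symm _) = _
      rw [h1, Submodule.mkQ_apply, Submodule.liftQ_apply]
      simp [l]
    have h1 := hs φ
    rw [map_sum] at h1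
    simp only [pairExc_tmul, hφ] at h1
    exact h1
  obtain ⟨w, hw⟩ := exists_formalSum_pi_of_torsion hn g
  -- Testing `g ∘ D = F` on torsion vectors `q e i` shows that `z` is a combination of relations, up
  -- to multiples of `n`.
  have hu : ∀ i, ∃ v, z i - ∑ j, κ j i • w j = n • v := fun i =>
    exists_eq_nsmul_of_pairZero hn _ fun q hq => by
      have h1 := hg (Pi.single i q)
      have hD : D (Pi.single i q) = fun j => κ j i • q := by
        ext1 j
        change ∑ i', κ j i' • (Pi.single i q : Fin k → LaurentSum QZ) i' = _
        rw [Finset.sum_eq_single i (fun i' _ hi' => by rw [Pi.single_eq_of_ne hi', smul_zero])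
          (by simp), Pi.single_eq_same]
      have hF : F (Pi.single i q) = pairZero q (z i) := by
        change ∑ i', pairZero ((Pi.single i q : Fin k → LaurentSum QZ) i') (z i') = _
        rw [Finset.sum_eq_single i (fun i' _ hi' => by
          rw [Pi.single_eq_of_ne hi', map_zero, AddMonoidHom.zero_apply]) (by simp),
          Pi.single_eq_same]
      rw [hD, hF, hw _ (by
        ext1 j
        rw [Pi.smul_apply, smul_comm, hq, smul_zero, Pi.zero_apply])] at h1
      simp only [pairZero_smul, ← map_sum] at h1
      rw [map_sub, h1, sub_self]
  choose v hv using hu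
  have hz : ∀ i, z i = ∑ j, κ j i • w j + n • v i := fun i => by rw [← hv i]; abel
  have hn0 : ∀ i, f (Pi.single i 1) ⊗ₜ[ℤ[T;T⁻¹]] (n • v i) = 0 := fun i => by
    rw [← TensorProduct.smul_tmul, hnS, TensorProduct.zero_tmul]
  have hκs : ∀ j, ∑ i, κ j i • f (Pi.single i 1) = 0 := fun j => by
    rw [← hκ j]
    conv_rhs => rw [← Finset.univ_sum_single (κ j)]
    rw [map_sum]
    refine Finset.sum_congr rfl fun i _ => ?_
    rw [← map_smul, ← Pi.single_smul, smul_eq_mul, mul_one]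
  calc ∑ i, f (Pi.single i 1) ⊗ₜ[ℤ[T;T⁻¹]] z i
      = ∑ i, ∑ j, (κ j i • f (Pi.single i 1)) ⊗ₜ[ℤ[T;T⁻¹]] w j := by
        refine Finset.sum_congr rfl fun i _ => ?_
        rw [hz i, TensorProduct.tmul_add, hn0, add_zero, TensorProduct.tmul_sum]
        exact Finset.sum_congr rfl fun j _ => (TensorProduct.smul_tmul _ _ _).symm
    _ = ∑ j, (∑ i, κ j i • f (Pi.single i 1)) ⊗ₜ[ℤ[T;T⁻¹]] w j := by
        rw [Finset.sum_comm]
        exact Finset.sum_congr rfl fun j _ => (TensorProduct.sum_tmul _ _ _).symm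
    _ = 0 := Finset.sum_eq_zero fun j _ => by rw [hκs, TensorProduct.zero_tmul]

/-! ### The cokernel of `Φ` -/

theorem IsFusionTheory.finite_hom (hS : IsFusionTheory S) :
    Module.Finite ℤ[T;T⁻¹] (S →ₗ[ℤ[T;T⁻¹]] LaurentSum QZ) := by
  have := hS.fg
  obtain ⟨k, f, hf⟩ := Module.Finite.exists_fin' ℤ[T;T⁻¹] S
  obtain ⟨n, hn, hnS⟩ := hS.exists_exponent
  let V : Submodule ℤ[T;T⁻¹] (LaurentSum QZ) := Submodule.span ℤ[T;T⁻¹] {monomial 0 (invQZ n)}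
  have hV : ∀ (φ : S →ₗ[ℤ[T;T⁻¹]] LaurentSum QZ) (x : S), φ x ∈ V := fun φ x =>
    mem_span_of_torsion hn _ (by rw [← map_nsmul, hnS, map_zero])
  have hVn : IsNoetherian ℤ[T;T⁻¹] V :=
    isNoetherian_of_fg_of_noetherian V (Submodule.fg_span_singleton _)
  let D : (S →ₗ[ℤ[T;T⁻¹]] LaurentSum QZ) →ₗ[ℤ[T;T⁻¹]] (Fin k → V) :=
    { toFun := fun φ i => ⟨φ (f (Pi.single i 1)), hV φ _⟩
      map_add' := fun _ _ => rfl
      map_smul' := fun _ _ => rfl }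
  have hD : Function.Injective D := fun φ φ' h => by
    have h0 : φ ∘ₗ f = φ' ∘ₗ f := LinearMap.pi_ext' fun i =>
      LinearMap.ext_ring (congrArg Subtype.val (congrFun h i))
    refine LinearMap.ext fun x => ?_
    obtain ⟨r, rfl⟩ := hf x
    exact LinearMap.congr_fun h0 r
  have : IsNoetherian ℤ[T;T⁻¹] (Fin k → V) :=
    isNoetherian_pi (R := ℤ[T;T⁻¹]) (M := fun _ => V)
  have := isNoetherian_of_injective D hD
  infer_instance

namespace PTheory

variable (P : PTheory S)

theorem coeff_BFormHom (m : ℤ) (x y : S) :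
    coeff m (P.BFormHom x y) = P.b ((T m : ℤ[T;T⁻¹]) • x) y := rfl

theorem BFormHom_add (x y : S) : P.BFormHom (x + y) = P.BFormHom x + P.BFormHom y :=
  map_add P.Φ x y

theorem BFormHom_smul (r : ℤ[T;T⁻¹]) (x : S) :
    P.BFormHom (invert r • x) = r • P.BFormHom x := by
  refine LinearMap.ext fun y => ?_
  have h : P.Φ (invert r • x) = (invert r : ℤ[T;T⁻¹]) • P.Φ x := map_smul P.Φ _ _
  refine (congrArg (fun φ : Dual S => φ.eval y) h).trans ?_
  rw [Dual.smul_eval, involutive_invert r]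
  exact map_smul (P.BFormHom x) r y

/-- The image of `Φ`, as a submodule of the homomorphisms from `S` to the Laurent polynomials over
`ℚ/ℤ` with the untwisted module structure. -/
def imageΦ : Submodule ℤ[T;T⁻¹] (S →ₗ[ℤ[T;T⁻¹]] LaurentSum QZ) where
  carrier := Set.range P.BFormHom
  zero_mem' := ⟨0, map_zero P.Φ⟩
  add_mem' := by
    rintro _ _ ⟨x, rfl⟩ ⟨y, rfl⟩
    exact ⟨x + y, P.BFormHom_add x y⟩
  smul_mem' := by
    rintro r _ ⟨x, rfl⟩
    exact ⟨invert r • x, P.BFormHom_smul r x⟩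

theorem mem_imageΦ {φ : S →ₗ[ℤ[T;T⁻¹]] LaurentSum QZ} :
    φ ∈ P.imageΦ ↔ ∃ x, P.BFormHom x = φ := Iff.rfl

variable {P} in
theorem IsPModular.Φ_injective (hP : P.IsPModular) : Function.Injective P.Φ := by
  refine (injective_iff_map_eq_zero P.Φ).2 fun x hx => hP.1 x fun y => ?_
  have h := congrArg (fun φ : Dual S => coeff 0 (φ.eval y)) hx
  refine Eq.trans ?_ h
  change P.b x y = P.b ((T 0 : ℤ[T;T⁻¹]) • x) y
  rw [T_zero, one_smul]

variable {P} in
theorem IsPModular.isPerfect_iff (hP : P.IsPModular) : P.IsPerfect ↔ P.imageΦ = ⊤ := by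
  rw [Submodule.eq_top_iff']
  exact ⟨fun h φ => h.2 φ, fun h => ⟨hP.Φ_injective, fun φ => h φ⟩⟩

/-- The map `Φ` is surjective as soon as it is surjective modulo `1 - t ^ N` for all large `N`. -/
theorem imageΦ_eq_top (N₀ : ℕ+) (h : ∀ N : ℕ+, N₀ ≤ N → ∀ φ : S →ₗ[ℤ[T;T⁻¹]] LaurentSum QZ,
    ∃ φ', φ - (φ' - (T (N : ℤ) : ℤ[T;T⁻¹]) • φ') ∈ P.imageΦ) : P.imageΦ = ⊤ := by
  have := P.fusion.finite_hom
  obtain ⟨n, hn, hnS⟩ := P.fusion.exists_exponent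
  have h0 : ∀ φ : S →ₗ[ℤ[T;T⁻¹]] LaurentSum QZ, n • φ = 0 := fun φ => LinearMap.ext fun x => by
    rw [LinearMap.smul_apply, ← map_nsmul, hnS, map_zero, LinearMap.zero_apply]
  exact eq_top_of_one_sub_T_surjective (M := S →ₗ[ℤ[T;T⁻¹]] LaurentSum QZ) P.imageΦ hn h0 N₀ h

/-! ### Infinite and periodic excitations -/

theorem bTilde_separatingRight (h : P.imageΦ = ⊤) : P.bTilde.SeparatingRight := fun s hs =>
  eq_zero_of_pairExc P.fusion s fun φ => by
    obtain ⟨x, rfl⟩ := P.mem_imageΦ.1 (h ▸ Submodule.mem_top : φ ∈ P.imageΦ)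
    exact hs x

/-- The formal sum `∑ m, t ^ (m N)`. -/
def comb (N : ℕ+) : FormalSum ℤ := fun m => if (N : ℤ) ∣ m then 1 else 0

theorem T_smul_comb (N : ℕ+) : (T (N : ℤ) : ℤ[T;T⁻¹]) • comb N = comb N := by
  funext m
  rw [T_smul_formalSum]
  simp only [comb, dvd_sub_self_right]

/-- If `b x y ≠ 0`, then `x` pairs to the same value with the periodic excitation
`∑ m, t ^ (m N) y`, for every `N` so large that the other translates do not contribute. -/
theorem bTildePer_separatingLeft (hP : P.IsPModular) : P.bTildePer.SeparatingLeft := by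
  intro x hx
  refine hP.1 x fun y => ?_
  obtain ⟨l, hl⟩ := P.locality x y
  let N : ℕ+ := l.succPNat
  have hN : (N : ℤ) = l + 1 := by simp [N]
  let s : S ⊗[ℤ[T;T⁻¹]] FormalSum ℤ := y ⊗ₜ comb N
  have hs : (T (N : ℤ) : ℤ[T;T⁻¹]) • s = s := by
    rw [TensorProduct.smul_tmul', TensorProduct.smul_tmul, T_smul_comb]
  refine Eq.trans ?_ (hx ⟨s, N, hs⟩)
  change _ = ∑ᶠ i : ℤ, comb N (0 - i) • P.b ((T i : ℤ[T;T⁻¹]) • x) y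
  rw [finsum_eq_single _ 0 fun i hi => ?_]
  · simp [comb]
  · by_cases hd : (N : ℤ) ∣ i
    · have := Int.le_of_dvd (abs_pos.2 hi) ((dvd_abs _ _).2 hd)
      rw [hl i (by omega), smul_zero]
    · simp [comb, hd]

/-- Every `φ` lies in `Φ(S) + (1 - t ^ N) S*`: a character of `S*` that vanishes on this submodule
is a periodic excitation in the kernel of `b̃`, hence zero. -/
theorem exists_sub_mem_imageΦ (h : P.bTildePer.SeparatingRight) (N : ℕ+)
    (φ : S →ₗ[ℤ[T;T⁻¹]] LaurentSum QZ) :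
    ∃ φ', φ - (φ' - (T (N : ℤ) : ℤ[T;T⁻¹]) • φ') ∈ P.imageΦ := by
  let τ := LinearMap.lsmul ℤ[T;T⁻¹] (S →ₗ[ℤ[T;T⁻¹]] LaurentSum QZ) (1 - T (N : ℤ))
  have hτ : ∀ φ, τ φ = φ - (T (N : ℤ) : ℤ[T;T⁻¹]) • φ := fun φ =>
    (sub_smul 1 (T (N : ℤ)) φ).trans (by rw [one_smul])
  suffices hφ : φ ∈ LinearMap.range τ ⊔ P.imageΦ by
    obtain ⟨_, ⟨φ', rfl⟩, x, hx, rfl⟩ := Submodule.mem_sup.1 hφ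
    exact ⟨φ', by rwa [← hτ, add_sub_cancel_left (τ φ') x]⟩
  by_contra hφ
  obtain ⟨ψ, hψ, hψφ⟩ := exists_character_ne_zero
    (A := S →ₗ[ℤ[T;T⁻¹]] LaurentSum QZ) (LinearMap.range τ ⊔ P.imageΦ).toAddSubgroup hφ
  obtain ⟨s, hs⟩ := exists_pairExc_eq P.fusion ψ
  have hper : (T (N : ℤ) : ℤ[T;T⁻¹]) • s = s := by
    rw [← sub_eq_zero]
    refine eq_zero_of_pairExc P.fusion _ fun φ' => ?_
    have h1 := hψ (τ φ') (Submodule.mem_sup_left ⟨φ', rfl⟩)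
    rw [hτ, map_sub ψ φ', sub_eq_zero] at h1
    rw [map_sub, pairExc_smul, hs, hs, h1, sub_self]
  have h0 : (⟨s, N, hper⟩ : PerExc S) = 0 := h _ fun x => (hs (P.BFormHom x)).trans
    (hψ _ (Submodule.mem_sup_right ⟨x, rfl⟩))
  have hs0 : s = 0 := congrArg Subtype.val h0
  rw [← hs φ, hs0, map_zero] at hψφ
  exact hψφ rfl

/-! ### Compactification -/

/-- The `t ^ 0` coefficient summed over all translations by multiples of `N`: a homomorphism from
`S` to the Laurent polynomials over `ℚ/ℤ` thus induces a character of `S_N`. -/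
def periodize (N : ℕ+) (φ : S →ₗ[ℤ[T;T⁻¹]] LaurentSum QZ) : S →+ QZ :=
  AddMonoidHom.mk' (fun y => ∑ᶠ j : ℤ, coeff (0 + j * N) (φ y)) fun y y' => by
    simp only [map_add]
    exact finsum_add_distrib (finite_support_residue N (φ y) 0) (finite_support_residue N (φ y') 0)

theorem periodize_T_smul (N : ℕ+) (φ : S →ₗ[ℤ[T;T⁻¹]] LaurentSum QZ) (k : ℤ) (y : S) :
    periodize N φ ((T k : ℤ[T;T⁻¹]) • y) = ∑ᶠ j : ℤ, coeff (-k + j * N) (φ y) := by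
  refine finsum_congr fun j => ?_
  rw [map_smul, coeff_T_smul]
  congr 2
  ring

theorem periodize_T_smul_self (N : ℕ+) (φ : S →ₗ[ℤ[T;T⁻¹]] LaurentSum QZ) (y : S) :
    periodize N φ ((T (N : ℤ) : ℤ[T;T⁻¹]) • y) = periodize N φ y := by
  rw [periodize_T_smul, ← finsum_comp_equiv (Equiv.addRight (1 : ℤ))]
  refine finsum_congr fun j => ?_
  rw [Equiv.coe_addRight]
  congr 2
  ring

theorem periodize_sub (N : ℕ+) (φ φ' : S →ₗ[ℤ[T;T⁻¹]] LaurentSum QZ) (y : S) :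
    periodize N (φ - φ') y = periodize N φ y - periodize N φ' y := by
  rw [eq_sub_iff_add_eq]
  change ∑ᶠ j : ℤ, _ + ∑ᶠ j : ℤ, _ = ∑ᶠ j : ℤ, _
  rw [← finsum_add_distrib (finite_support_residue N _ 0) (finite_support_residue N _ 0)]
  refine finsum_congr fun j => ?_
  rw [← map_add, LinearMap.sub_apply, sub_add_cancel]

theorem periodize_BFormHom (N : ℕ+) (x y : S) :
    periodize N (P.BFormHom x) y = P.bN N (ρ N x) (ρ N y) := by
  rw [bN_ρ]
  refine finsum_congr fun j => ?_
  rw [zero_add, coeff_BFormHom]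

/-- A homomorphism that induces the zero character of `S_N` is a multiple of `1 - t ^ N`. -/
theorem exists_sub_T_smul_of_periodize (N : ℕ+) (φ : S →ₗ[ℤ[T;T⁻¹]] LaurentSum QZ)
    (h : ∀ y, periodize N φ y = 0) : ∃ φ', φ = φ' - (T (N : ℤ) : ℤ[T;T⁻¹]) • φ' := by
  let τ : LaurentSum QZ →ₗ[ℤ[T;T⁻¹]] LaurentSum QZ :=
    LinearMap.id - (T (N : ℤ) : ℤ[T;T⁻¹]) • LinearMap.id
  have hτ : ∀ q, τ q = q - (T (N : ℤ) : ℤ[T;T⁻¹]) • q := fun _ => rfl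
  have hinj : Function.Injective τ := (injective_iff_map_eq_zero τ).2 fun q hq =>
    eq_zero_of_T_smul_eq N q (by rw [hτ, sub_eq_zero] at hq; exact hq.symm)
  have hmem : ∀ y, φ y ∈ LinearMap.range τ := fun y => by
    obtain ⟨p, hp⟩ := exists_sub_T_smul N (φ y) fun k => by
      rw [← h ((T (-k) : ℤ[T;T⁻¹]) • y), periodize_T_smul, neg_neg]
    exact ⟨p, hp.symm⟩
  refine ⟨(LinearEquiv.ofInjective τ hinj).symm.toLinearMap ∘ₗ φ.codRestrict _ hmem,
    LinearMap.ext fun y => ?_⟩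
  have h1 := congrArg Subtype.val
    ((LinearEquiv.ofInjective τ hinj).apply_symm_apply (φ.codRestrict _ hmem y))
  exact h1.symm

theorem bN_symm (N : ℕ+) (x y : Compact S N) : P.bN N x y = P.bN N y x := by
  obtain ⟨x, rfl⟩ := ρ_surjective N x
  obtain ⟨y, rfl⟩ := ρ_surjective N y
  rw [bN_ρ, bN_ρ, ← finsum_comp_equiv (Equiv.neg ℤ)]
  refine finsum_congr fun j => ?_
  rw [P.b_T_left, P.symm, Equiv.neg_apply, neg_mul, neg_neg]

theorem T_smul_compact (N : ℕ+) (x : Compact S N) : (T (N : ℤ) : ℤ[T;T⁻¹]) • x = x := by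
  obtain ⟨x, rfl⟩ := ρ_surjective N x
  rw [← map_smul]
  exact ((ρ_eq_iff N _ _).2 ⟨x, rfl⟩).symm

theorem _root_.Planon.IsFusionTheory.finite_compact (hS : IsFusionTheory S) (N : ℕ+) :
    Finite (Compact S N) := by
  have := hS.fg
  have : Module.Finite ℤ[T;T⁻¹] (Compact S N) := Module.Finite.of_surjective _ (ρ_surjective N)
  refine finite_of_T_smul (fun x => ?_) N (T_smul_compact N)
  obtain ⟨x, rfl⟩ := ρ_surjective N x
  obtain ⟨m, hm, hx⟩ := hS.finite_order x
  exact ⟨m, hm, by rw [← map_nsmul, hx, map_zero]⟩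

/-- For surjective `Φ` the form `b_N` is nondegenerate: if `ρ x` is in its kernel, then
`Φ x = (1 - t ^ N) φ` for some `φ`, and `φ` is in the image of `Φ`. -/
theorem IsPModular.isModularAnyonPTheory {P : PTheory S} (hP : P.IsPModular) (h : P.imageΦ = ⊤)
    (N : ℕ+) : IsModularAnyonPTheory (Compact S N) (P.bN N) := by
  have hl : (P.bN N).SeparatingLeft := fun x hx => by
    obtain ⟨x, rfl⟩ := ρ_surjective N x
    obtain ⟨φ, hφ⟩ := exists_sub_T_smul_of_periodize N (P.BFormHom x) fun y => by
      rw [periodize_BFormHom, hx]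
    obtain ⟨z, rfl⟩ := P.mem_imageΦ.1 (h ▸ Submodule.mem_top : φ ∈ P.imageΦ)
    have hxz : x + (T (-(N : ℤ)) : ℤ[T;T⁻¹]) • z = z := hP.Φ_injective (by
      change P.BFormHom _ = P.BFormHom _
      have h1 := P.BFormHom_smul (T (N : ℤ)) z
      rw [invert_T] at h1
      rw [BFormHom_add, h1, hφ]
      exact sub_add_cancel (P.BFormHom z) _)
    refine (ρ_eq_iff N x 0).2 ⟨-(T (-(N : ℤ)) : ℤ[T;T⁻¹]) • z, ?_⟩
    rw [neg_smul, smul_neg, ← mul_smul, ← T_add, add_neg_cancel, T_zero, one_smul, sub_zero]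
    rw [sub_neg_eq_add, eq_neg_add_iff_add_eq, add_comm, hxz]
  refine ⟨P.fusion.finite_compact N, P.bN_symm N, hl, fun y hy => hl y fun x => ?_⟩
  rw [P.bN_symm, hy]

/-- If `b_N` is nondegenerate, then the character of `S_N` induced by `φ` is also induced by `Φ x`
for some `x`, so that `φ - Φ x` is a multiple of `1 - t ^ N`. -/
theorem exists_sub_mem_imageΦ_of_isModularAnyonPTheory (N : ℕ+)
    (h : IsModularAnyonPTheory (Compact S N) (P.bN N)) (φ : S →ₗ[ℤ[T;T⁻¹]] LaurentSum QZ) :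
    ∃ φ', φ - (φ' - (T (N : ℤ) : ℤ[T;T⁻¹]) • φ') ∈ P.imageΦ := by
  have := h.1
  obtain ⟨f, hf⟩ := exists_character_comp (ρ N).toAddMonoidHom (periodize N φ) fun y hy => by
    obtain ⟨z, hz⟩ := (ρ_eq_iff N y 0).1 (hy.trans (map_zero _).symm)
    rw [sub_zero] at hz
    rw [hz, map_sub, periodize_T_smul_self, sub_self]
  obtain ⟨x, hx⟩ := exists_eq_of_separating (P.bN N) h.2.2.2 f
  obtain ⟨x, rfl⟩ := ρ_surjective N x
  obtain ⟨φ', hφ'⟩ := exists_sub_T_smul_of_periodize N (φ - P.BFormHom x) fun y => by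
    rw [periodize_sub, periodize_BFormHom, hx, ← hf]
    exact sub_self _
  exact ⟨φ', P.mem_imageΦ.2 ⟨x, by rw [← hφ']; exact (sub_sub_cancel φ _).symm⟩⟩

theorem IsPModular.tfae {P : PTheory S} (hP : P.IsPModular) : List.TFAE [
    P.bTilde.Nondegenerate,
    P.bTildePer.Nondegenerate,
    ∀ N : ℕ+, IsModularAnyonPTheory (Compact S N) (P.bN N),
    ∃ N₀ : ℕ+, ∀ N : ℕ+, N₀ ≤ N → IsModularAnyonPTheory (Compact S N) (P.bN N),
    P.IsPerfect] := by
  rw [hP.isPerfect_iff]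
  have hl := P.bTildePer_separatingLeft hP
  tfae_have 1 → 2 := fun h => ⟨hl, fun s hs => Subtype.ext (h.2 s.1 hs)⟩
  tfae_have 2 → 5 := fun h => P.imageΦ_eq_top 1 fun N _ => P.exists_sub_mem_imageΦ h.2 N
  tfae_have 5 → 1 := fun h => ⟨fun x hx => hl x fun s => hx s.1, P.bTilde_separatingRight h⟩
  tfae_have 5 → 3 := fun h N => hP.isModularAnyonPTheory h N
  tfae_have 3 → 4 := fun h => ⟨1, fun N _ => h N⟩
  tfae_have 4 → 5 := fun ⟨N₀, h⟩ => P.imageΦ_eq_top N₀ fun N hN =>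
    P.exists_sub_mem_imageΦ_of_isModularAnyonPTheory N (h N hN)
  tfae_finish

end PTheory

/-! ### Theories of excitations -/

theorem finsum_int {A : Type*} [AddCommGroup A] (f : ℤ → A) (hf : (Function.support f).Finite) :
    ∑ᶠ j : ℤ, f j = f 0 + (∑ᶠ j : ℕ, f (j + 1) + ∑ᶠ j : ℕ, f (-(j + 1))) := by
  have h1 : ∑ᶠ j : ℕ, f j = f 0 + ∑ᶠ j : ℕ, f (j + 1) := by
    rw [← PTheory.finsum_nat_succ (fun j : ℕ => f j)]
    · simp
    · exact hf.preimage (f := fun j : ℕ => ((j + 1 : ℕ) : ℤ)) (fun i _ j _ h => by simpa using h)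
  rw [← add_assoc, ← h1,
    ← finsum_mem_range (f := f) (g := fun j : ℕ => (j : ℤ)) Nat.cast_injective,
    ← finsum_mem_range (f := f) (g := fun j : ℕ => -((j : ℤ) + 1)) fun i j h => by simpa using h,
    ← finsum_mem_union' _ (hf.inter_of_right _) (hf.inter_of_right _), finsum_mem_def]
  · refine finsum_congr fun j => (Set.indicator_apply_eq_self.2 fun hj => absurd ?_ hj).symm
    obtain h | h := le_or_gt 0 j
    · exact Or.inl ⟨j.toNat, Int.toNat_of_nonneg h⟩
    · refine Or.inr ⟨(-j - 1).toNat, ?_⟩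
      have := Int.toNat_of_nonneg (a := -j - 1) (by omega)
      simp only
      omega
  · rw [Set.disjoint_left]
    rintro _ ⟨i, rfl⟩ ⟨j, hj⟩
    simp only at hj
    omega

namespace TheoryOfExcitations

variable (E : TheoryOfExcitations S)

/-- The bilinear form associated with `θ_N` is `b_N`. -/
theorem polarBilin_θN (N : ℕ+) : (E.θN N).polarBilin = E.toPTheory.bN N := by
  refine LinearMap.ext₂ fun x y => ?_
  obtain ⟨x, rfl⟩ := ρ_surjective N x
  obtain ⟨y, rfl⟩ := ρ_surjective N y
  have h : ∀ z, E.θN N (ρ N z) = E.θPre N z := fun z => E.θN_ρ N z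
  rw [QuadraticMap.polarBilin_apply_apply, PTheory.bN_ρ,
    finsum_int _ (E.toPTheory.finite_support_N N x y), zero_mul, T_zero, one_smul]
  refine Eq.trans ?_ ((E.θPre_polar N x y).trans ?_)
  · simp only [QuadraticMap.polar, ← map_add, h]
  · rw [add_comm (E.toPTheory.bHalf N x y)]
    congr 2
    · refine finsum_congr fun j => ?_
      rw [E.toPTheory.symm]
    · refine finsum_congr fun j => ?_
      rw [E.toPTheory.b_T_right, neg_mul]

theorem isModularAnyonTheory_iff (N : ℕ+) : IsModularAnyonTheory (Compact S N) (E.θN N) ↔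
    IsModularAnyonPTheory (Compact S N) (E.toPTheory.bN N) := by
  rw [IsModularAnyonTheory, IsModularAnyonPTheory, polarBilin_θN]
  exact ⟨fun h => ⟨h.1, E.toPTheory.bN_symm N, h.2⟩, fun h => ⟨h.1, h.2.2⟩⟩

end TheoryOfExcitations

end Planon

end

theorem theorem8p1 {S : Type*} [AddCommGroup S] [Module ℤ[T;T⁻¹] S] :
    (∀ P : Planon.PTheory S, P.IsPModular → List.TFAE [
      P.bTilde.Nondegenerate,
      P.bTildePer.Nondegenerate,
      ∀ N : ℕ+, Planon.IsModularAnyonPTheory (Planon.Compact S N) (P.bN N),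
      ∃ N₀ : ℕ+, ∀ N : ℕ+, N₀ ≤ N → Planon.IsModularAnyonPTheory (Planon.Compact S N) (P.bN N),
      P.IsPerfect]) ∧
    (∀ E : Planon.TheoryOfExcitations S, E.IsPModular → List.TFAE [
      E.toPTheory.bTilde.Nondegenerate,
      E.toPTheory.bTildePer.Nondegenerate,
      ∀ N : ℕ+, Planon.IsModularAnyonTheory (Planon.Compact S N) (E.θN N),
      ∃ N₀ : ℕ+, ∀ N : ℕ+, N₀ ≤ N → Planon.IsModularAnyonTheory (Planon.Compact S N) (E.θN N),
      E.toPTheory.IsPerfect]) :=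
  ⟨fun _ hP => hP.tfae, fun E hE => by
    simp only [E.isModularAnyonTheory_iff]
    exact Planon.PTheory.IsPModular.tfae (P := E.toPTheory) hE⟩
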